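/- Let $\mathbf n=(n_1,\dots,n_k)\in\mathbb N^k$ with $k\ge 1$ and $n_i\ge 2$ for all $i$, and let $\mathcal H$ be a complex Hilbert space. Consider tuples $\mathbf T=(T_1,\dots,T_k)$, $T_i=(T_{i,1},\dots,T_{i,n_i})$, of bounded operators on $\mathcal H$. Put $\Phi_{T_i}(Y)=\sum_{j=1}^{n_i}T_{i,j}YT_{i,j}^*$ and $\mathbf\Delta_{\mathbf T}=(\mathrm{id}-\Phi_{T_1})\circ\cdots\circ(\mathrm{id}-\Phi_{T_k})$. The regular polyball $\mathbf B_{\mathbf n}(\mathcal H)$ consists of the tuples such that $T_{i,j}$ commutes with $T_{s,t}$ whenever $i\ne s$ and $(\mathrm{id}-\Phi_{T_1})^{p_1}\circ\cdots\circ(\mathrm{id}-\Phi_{T_k})^{p_k}(I)\ge 0$ for all $p_1,\dots,p_k\in\{0,1\}$. The tuple $\mathbf T$ has finite rank if $\mathbf\Delta_{\mathbf T}(I)$ has finite rank, and it is pure if $\Phi_{T_i}^p(I)\to 0$ strongly as $p\to\infty$ for every $i$. For a word $\alpha=g_{j_1}\cdots g_{j_p}$ in the free semigroup $\mathbb F_{n_i}^+$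 on $n_i$ generators, put $|\alpha|=p$ and $T_{i,\alpha}=T_{i,j_1}\cdots T_{i,j_p}$. Let $F^2(H_{n_i})$ be the full Fock space on $n_i$ generators with orthonormal basis $\{e^i_\alpha\}_{\alpha\in\mathbb F_{n_i}^+}$, let $P^{(i)}_q$ be the orthogonal projection onto the span of the $e^i_\alpha$ with $|\alpha|=q$, and for $\mathbf T\in\mathbf B_{\mathbf n}(\mathcal H)$ let $\mathbf K_{\mathbf T}:\mathcal H\to F^2(H_{n_1})\otimes\cdots\otimes F^2(H_{n_k})\otimes\overline{\mathbf\Delta_{\mathbf T}(I)\mathcal H}$, $$\mathbf K_{\mathbf T}h=\sum_{\beta_1,\dots,\beta_k}e^1_{\beta_1}\otimes\cdots\otimes e^k_{\beta_k}\otimes\mathbf\Delta_{\mathbf T}(I)^{1/2}T_{1,\beta_1}^*\cdots T_{k,\beta_k}^*h ,$$ be the Berezin kernel. If $\mathbf\Delta_{\mathbf T}(I)$ is of trace class, the curvature of $\mathbf T$ is $$\operatorname{curv}(\mathbf T)=\lim_{m\to\infty}\frac1{\binom{m+k}{k}}\sum_{q_1,\dots,q_k\ge0,\ q_1+\cdots+q_k\le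 m}\frac{\operatorname{trace}\big[\mathbf K_{\mathbf T}^*(P^{(1)}_{q_1}\otimes\cdots\otimes P^{(k)}_{q_k}\otimes I)\mathbf K_{\mathbf T}\big]}{\operatorname{trace}\big[P^{(1)}_{q_1}\otimes\cdots\otimes P^{(k)}_{q_k}\big]}.$$ If $\mathbf T$ has finite rank, put $M_{\mathbf q}(\mathbf T)=\operatorname{span}\{T_{1,\alpha_1}\cdots T_{k,\alpha_k}h:\ |\alpha_i|\le q_i,\ h\in\mathbf\Delta_{\mathbf T}(I)\mathcal H\}$ for $\mathbf q\in\mathbb Z_+^k$; the Euler characteristic of $\mathbf T$ is $$\chi(\mathbf T)=\lim_{m\to\infty}\frac{\dim M_{\mathbf q^{(m)}}(\mathbf T)}{\prod_{i=1}^k(1+n_i+\cdots+n_i^{q_i^{(m)}})},$$ where $(\mathbf q^{(m)})$ is any increasing cofinal sequence in $\mathbb Z_+^k$. Let $\mathbf T\in\mathbf B_{\mathbf n}(\mathcal H)$ be pure and of finite rank, and suppose that $\mathbf T$ is graded with respect to a gauge group $U$, that is, $U:\mathbb T^k\to B(\mathcal H)$ is a strongly continuous unitary representation of the $k$-torus with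 $U(\lambda)T_{i,j}U(\lambda)^*=\lambda_iT_{i,j}$ for all $\lambda\in\mathbb T^k$ and all $i,j$. For $\mathbf s\in\mathbb Z^k$ let $\mathcal H_{\mathbf s}=\{h\in\mathcal H:\ U(\lambda)h=\lambda_1^{s_1}\cdots\lambda_k^{s_k}h\text{ for all }\lambda\in\mathbb T^k\}$ be the spectral subspaces of $U$. Then every $\mathcal H_{\mathbf s}$ is finite dimensional, and there exist $\mathbf c\le\mathbf d$ in $\mathbb Z^k$ (coordinatewise order) such that $\mathcal H=\bigoplus_{\mathbf s\ge\mathbf c}\mathcal H_{\mathbf s}$ (Hilbert direct sum) and such that $\mathcal H_0:=\bigoplus_{\mathbf s\ge\mathbf d}\mathcal H_{\mathbf s}$ is invariant under all $T_{i,j}$, the restriction $\mathbf T|_{\mathcal H_0}$ is a finite rank element of $\mathbf B_{\mathbf n}(\mathcal H_0)$, both $\operatorname{curv}(\mathbf T|_{\mathcal H_0})$ and $\chi(\mathbf T|_{\mathcal H_0})$ exist, and $$\operatorname{curv}(\mathbf T|_{\mathcal H_0})=\chi(\mathbf T|_{\mathcal H_0}).$$ -/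

import Mathlib

open Filter Topology
open scoped InnerProductSpace

namespace Polyball

noncomputable section

/-- Tuples `T = (T_1, …, T_k)` with `T_i = (T_{i,1}, …, T_{i,n_i})` of bounded operators on `H`. -/
abbrev OpTuple {k : ℕ} (n : Fin k → ℕ) (H : Type*) [NormedAddCommGroup H]
    [InnerProductSpace ℂ H] : Type _ :=
  (i : Fin k) → Fin (n i) → (H →L[ℂ] H)

/-- Elements `(α_1, …, α_k)` of the product of the free semigroups on `n_i` generators. -/
abbrev MultiWord {k : ℕ} (n : Fin k → ℕ) : Type := (i : Fin k) → List (Fin (n i))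

section Operators

variable {H : Type*} [NormedAddCommGroup H] [InnerProductSpace ℂ H]
variable {k : ℕ} {n : Fin k → ℕ}

/-- `T_{i,α} = T_{i,j_1} ⋯ T_{i,j_p}` for the word `α = g_{j_1} ⋯ g_{j_p}`. -/
def wordOp (T : OpTuple n H) (i : Fin k) (α : List (Fin (n i))) : H →L[ℂ] H :=
  (α.map (T i)).prod

/-- `T_{1,α_1} ⋯ T_{k,α_k}`. -/
def multiWordOp (T : OpTuple n H) (α : MultiWord n) : H →L[ℂ] H :=
  (List.ofFn fun i => wordOp T i (α i)).prod

/-- `M` is invariant under all the operators `T_{i,j}`. -/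
def IsInvariant (T : OpTuple n H) (M : Submodule ℂ H) : Prop :=
  ∀ (i : Fin k) (j : Fin (n i)), ∀ h ∈ M, T i j h ∈ M

/-- The restriction of the tuple `T` to an invariant subspace `M`. -/
def restrict (T : OpTuple n H) (M : Submodule ℂ H) (hM : IsInvariant T M) : OpTuple n M :=
  fun i j => ((T i j).comp M.subtypeL).codRestrict M fun h => hM i j h h.2

variable [CompleteSpace H]

/-- The completely positive map `Φ_{T_i}(Y) = ∑_j T_{i,j} Y T_{i,j}^*`. -/
def cpMap (T : OpTuple n H) (i : Fin k) : Module.End ℂ (H →L[ℂ] H) where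
  toFun Y := ∑ j, T i j * Y * star (T i j)
  map_add' X Y := by simp only [mul_add, add_mul, Finset.sum_add_distrib]
  map_smul' c Y := by
    simp only [mul_smul_comm, smul_mul_assoc, Finset.smul_sum, RingHom.id_apply]

/-- The defect mapping `(id - Φ_{T_1})^{p_1} ∘ ⋯ ∘ (id - Φ_{T_k})^{p_k}`. -/
def defectMap (T : OpTuple n H) (p : Fin k → ℕ) : Module.End ℂ (H →L[ℂ] H) :=
  (List.ofFn fun i => (1 - cpMap T i) ^ p i).prod

/-- The defect operator `Δ_T(I) = (id - Φ_{T_1}) ∘ ⋯ ∘ (id - Φ_{T_k}) (I)`. -/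
def defect (T : OpTuple n H) : H →L[ℂ] H :=
  defectMap T (fun _ => 1) 1

/-- Membership in the regular polyball `B_n(H)`. -/
structure MemPolyball (T : OpTuple n H) : Prop where
  commute : ∀ s t : Fin k, s ≠ t → ∀ (i : Fin (n s)) (j : Fin (n t)), Commute (T s i) (T t j)
  isPositive : ∀ p : Fin k → ℕ, (∀ i, p i ≤ 1) → (defectMap T p 1).IsPositive

/-- `T` is pure: `Φ_{T_i}^p(I) → 0` strongly as `p → ∞`, for every `i`. -/
def IsPure (T : OpTuple n H) : Prop :=
  ∀ (i : Fin k) (h : H), Tendsto (fun p : ℕ => ((cpMap T i) ^ p) 1 h) atTop (𝓝 0)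

/-- `T` has finite rank: its defect operator has finite rank. -/
def HasFiniteRank (T : OpTuple n H) : Prop :=
  FiniteDimensional ℂ (defect T).range

end Operators

section Trace

variable {E : Type*} [NormedAddCommGroup E] [InnerProductSpace ℂ E] [CompleteSpace E]

/-- The trace, in `[0, ∞]`, of a positive bounded operator: the sum `∑ ⟪v, A v⟫` over an
orthonormal basis of the Hilbert space (for positive operators the sum does not depend on the
basis). -/
def opTrace (A : E →L[ℂ] E) : ENNReal :=
  ∑' v : (exists_hilbertBasis ℂ E).choose, ENNReal.ofReal (RCLike.re ⟪(v : E), A v⟫_ℂ)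

end Trace

section Fock

variable {k : ℕ} (n : Fin k → ℕ)

/-- The Hilbert space `F²(H_{n_1}) ⊗ ⋯ ⊗ F²(H_{n_k}) ⊗ D`, in the orthonormal basis
`e_{β_1} ⊗ ⋯ ⊗ e_{β_k}` of the tensor product of the full Fock spaces: the element
`∑_β e_{β_1} ⊗ ⋯ ⊗ e_{β_k} ⊗ f_β` is the square summable family `(f_β)_β` of vectors of `D`.
For `D = ℂ` it is `F²(H_{n_1}) ⊗ ⋯ ⊗ F²(H_{n_k})` itself. -/
abbrev FockTensor (D : Type*) [NormedAddCommGroup D] : Type _ :=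
  lp (fun _ : MultiWord n => D) 2

variable (D : Type*) [NormedAddCommGroup D] [InnerProductSpace ℂ D]

/-- The closed subspace spanned by the `e_{β_1} ⊗ ⋯ ⊗ e_{β_k} ⊗ x` with `|β_i| = q_i`
for all `i`. -/
def fockLevel (q : Fin k → ℕ) : Submodule ℂ (FockTensor n D) where
  carrier := {f | ∀ β : MultiWord n, (¬ ∀ i, (β i).length = q i) → f β = 0}
  add_mem' := by
    intro f g hf hg β hβ
    simp [hf β hβ, hg β hβ]
  zero_mem' := by
    intro β _
    simp
  smul_mem' := by
    intro c f hf β hβ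
    simp [hf β hβ]

theorem isClosed_fockLevel (q : Fin k → ℕ) :
    IsClosed (fockLevel n D q : Set (FockTensor n D)) := by
  have h : (fockLevel n D q : Set (FockTensor n D)) =
      ⋂ (β : MultiWord n) (_ : ¬ ∀ i, (β i).length = q i), {f | f β = 0} := by
    ext f
    simp [fockLevel]
  rw [h]
  refine isClosed_iInter fun β => isClosed_iInter fun _ => ?_
  have hc : Continuous fun f : FockTensor n D => f β :=
    (continuous_apply β).comp (lp.uniformContinuous_coe (E := fun _ : MultiWord n => D)).continuous
  exact isClosed_eq hc continuous_const

variable [CompleteSpace D]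

instance (q : Fin k → ℕ) : CompleteSpace (fockLevel n D q) :=
  (isClosed_fockLevel n D q).completeSpace_coe

/-- The orthogonal projection `P_{q_1}^{(1)} ⊗ ⋯ ⊗ P_{q_k}^{(k)} ⊗ I_D`. -/
def fockProj (q : Fin k → ℕ) : FockTensor n D →L[ℂ] FockTensor n D :=
  (fockLevel n D q).starProjection

end Fock

section Invariants

variable {H : Type*} [NormedAddCommGroup H] [InnerProductSpace ℂ H] [CompleteSpace H]
variable {k : ℕ} {n : Fin k → ℕ}

/-- The defect space, the closure of the range of `Δ_T(I)`. -/
abbrev defectSpace (T : OpTuple n H) : Submodule ℂ H :=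
  (defect T).range.topologicalClosure

/-- `K` is the noncommutative Berezin kernel of `T`: it is the bounded operator with
`K h = ∑_β e_{β_1} ⊗ ⋯ ⊗ e_{β_k} ⊗ Δ_T(I)^{1/2} T_{1,β_1}^* ⋯ T_{k,β_k}^* h`.
There is at most one such operator. -/
def IsBerezinKernel (T : OpTuple n H) (K : H →L[ℂ] FockTensor n (defectSpace T)) : Prop :=
  ∀ (h : H) (β : MultiWord n),
    (K h β : H) = CFC.sqrt (defect T) ((List.ofFn fun i => star (wordOp T i (β i))).prod h)

/-- `trace [K^* (P_{q_1}^{(1)} ⊗ ⋯ ⊗ P_{q_k}^{(k)} ⊗ I) K] / trace [P_{q_1}^{(1)} ⊗ ⋯ ⊗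
P_{q_k}^{(k)}]`. -/
def curvRatio (T : OpTuple n H) (K : H →L[ℂ] FockTensor n (defectSpace T))
    (q : Fin k → ℕ) : ℝ :=
  (opTrace (ContinuousLinearMap.adjoint K ∘L fockProj n (defectSpace T) q ∘L K)).toReal /
    (opTrace (fockProj n ℂ q)).toReal

/-- The finite set of the `q = (q_1, …, q_k)` with `q_i ≥ 0` and `q_1 + ⋯ + q_k ≤ m`. -/
def simplex (k m : ℕ) : Finset (Fin k → ℕ) :=
  (Fintype.piFinset fun _ => Finset.range (m + 1)).filter fun q => ∑ i, q i ≤ m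

/-- The curvature of `T` exists and equals `x`: the defect operator is of trace class and, with
`K` the Berezin kernel of `T`, the averages of `curvRatio T K q` over the simplices
`q_1 + ⋯ + q_k ≤ m` converge to `x` as `m → ∞`. -/
def HasCurvature (T : OpTuple n H) (x : ℝ) : Prop :=
  opTrace (defect T) ≠ ⊤ ∧
    ∃ K : H →L[ℂ] FockTensor n (defectSpace T), IsBerezinKernel T K ∧
      Tendsto (fun m : ℕ => (1 / ((m + k).choose k : ℝ)) * ∑ q ∈ simplex k m, curvRatio T K q)
        atTop (𝓝 x)

/-- `M_q(T)`, the span of the `T_{1,α_1} ⋯ T_{k,α_k} h` with `|α_i| ≤ q_i` and `h` in the range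
of `Δ_T(I)`. -/
def eulerSpace (T : OpTuple n H) (q : Fin k → ℕ) : Submodule ℂ H :=
  Submodule.span ℂ {x | ∃ α : MultiWord n, (∀ i, (α i).length ≤ q i) ∧
    ∃ h ∈ (defect T).range, x = multiWordOp T α h}

/-- `dim M_q(T) / ∏_i (1 + n_i + ⋯ + n_i^{q_i})`. -/
def eulerRatio (T : OpTuple n H) (q : Fin k → ℕ) : ℝ :=
  (Module.finrank ℂ (eulerSpace T q) : ℝ) /
    ∏ i, ∑ r ∈ Finset.range (q i + 1), (n i : ℝ) ^ r

/-- The Euler characteristic of the finite rank tuple `T` exists and equals `x`: along every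
increasing cofinal sequence `q^{(m)}` the ratios `eulerRatio T (q^{(m)})` converge to `x`. -/
def HasEulerChar (T : OpTuple n H) (x : ℝ) : Prop :=
  HasFiniteRank T ∧
    ∀ q : ℕ → Fin k → ℕ, Monotone q → (∀ r : Fin k → ℕ, ∃ m, r ≤ q m) →
      Tendsto (fun m => eulerRatio T (q m)) atTop (𝓝 x)

end Invariants

section Gauge

variable {H : Type*} [NormedAddCommGroup H] [InnerProductSpace ℂ H] [CompleteSpace H]
variable {k : ℕ} {n : Fin k → ℕ}

/-- A gauge group: a strongly continuous unitary representation of the `k`-torus on `H`. -/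
structure GaugeGroup (k : ℕ) (H : Type*) [NormedAddCommGroup H] [InnerProductSpace ℂ H]
    [CompleteSpace H] where
  rep : (Fin k → Circle) →* unitary (H →L[ℂ] H)
  continuous_apply : ∀ h : H, Continuous fun z => (rep z : H →L[ℂ] H) h

/-- `T` is graded with respect to `U`: `U(z) T_{i,j} U(z)^* = z_i T_{i,j}`. -/
def IsGraded (T : OpTuple n H) (U : GaugeGroup k H) : Prop :=
  ∀ (z : Fin k → Circle) (i : Fin k) (j : Fin (n i)),
    (U.rep z : H →L[ℂ] H) * T i j * star (U.rep z : H →L[ℂ] H) = (z i : ℂ) • T i j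

/-- The spectral subspace `H_s` of `U`, for `s ∈ ℤ^k`. -/
def spectralSubspace (U : GaugeGroup k H) (s : Fin k → ℤ) : Submodule ℂ H where
  carrier := {h | ∀ z : Fin k → Circle,
    (U.rep z : H →L[ℂ] H) h = (∏ i, (z i : ℂ) ^ s i) • h}
  add_mem' := by
    intro x y hx hy z
    rw [map_add, hx z, hy z, smul_add]
  zero_mem' := by
    intro z
    rw [map_zero, smul_zero]
  smul_mem' := by
    intro c x hx z
    rw [map_smul, hx z, smul_comm]

/-- The closed linear span of the spectral subspaces `H_s` with `s ≥ d`; the `H_s` being pairwise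
orthogonal, it is the Hilbert direct sum `⨁_{s ≥ d} H_s`. -/
abbrev spectralSum (U : GaugeGroup k H) (d : Fin k → ℤ) : Submodule ℂ H :=
  (⨆ s : {s : Fin k → ℤ // d ≤ s}, spectralSubspace U s).topologicalClosure

end Gauge

end

end Polyball

namespace Polyball

/-! ### Weighted averages of a convergent net -/

section Averages

/-! The defect operator commutes with the gauge group and has finite rank, so it is nonzero on only
finitely many spectral subspaces; choose `c` and `d` bounding their degrees. Let `Δ_l` be the
product of the `id - Φ_{T_i}`, `i ∈ l`, applied to the identity. If `i ∉ l` and `Δ_{i :: l}` kills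
all degrees `s - q e_i`, then `Δ_l x = Φ_{T_i}^q(Δ_l) x` for every `x` of degree `s` and every `q`.
Since `Δ_l ≤ 1`, purity gives `Δ_l x = 0`. Hence a vector not killed by `Δ_l` leads, by lowering the
coordinates outside `l`, to a vector not killed by the full defect (`listDefect_bounds`). With `l`
empty, nonzero vectors live in degrees `≥ c`; with `l = [i]`, `∑_j T_{i,j} T_{i,j}^* x = x` as soon
as `s i > d i`.

So on the part of degree `≥ d` the restricted tuple `R` is a graded row-coisometric shift
(`IsGradedShift`) with finite dimensional pieces `V q`, `q ∈ ℕ^k`. There `Φ_{R_i}` turns operators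
that are scalar on each `V q` into operators of the same kind and translates their symbol by `e_i`.
The defect is therefore the projection onto `V 0`, and applying `∏ Φ_{R_i}^{q_i}` to it gives the
projection onto `V q` (`sum_conj_defect`). This makes both invariants averages of one function, `a q
= dim V q / ∏ n_i^{q_i}`: the curvature averages it uniformly over simplices, the Euler
characteristic over boxes with weights `∏ n_i^{q_i}`.

Coisometry gives `dim V (q + e_i) ≤ n_i dim V q`, so `a` decreases to a limit. In both averages the
weight off any cone `{q ≥ N}` is asymptotically negligible, so both converge to that limit
(`tendsto_weighted_average`).

The spectral subspaces exhaust `H` by Fourier analysis on the torus; they are finite dimensional by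
induction on the degree. -/

theorem abs_sum_weighted_le {ι : Type*} (S : Finset ι) (p : ι → Prop) [DecidablePred p]
    {w a : ι → ℝ} {x ε C : ℝ} (hw : ∀ q, 0 ≤ w q) (hε : ∀ q, p q → |a q - x| ≤ ε)
    (hC : ∀ q, |a q - x| ≤ C) :
    |∑ q ∈ S, w q * (a q - x)| ≤
      (∑ q ∈ S with p q, w q) * ε + (∑ q ∈ S with ¬ p q, w q) * C := by
  rw [← Finset.sum_filter_add_sum_filter_not S p, Finset.sum_mul, Finset.sum_mul]
  refine (abs_add_le _ _).trans (add_le_add ?_ ?_) <;>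
    refine (Finset.abs_sum_le_sum_abs _ _).trans (Finset.sum_le_sum fun q hq => ?_) <;>
    rw [abs_mul, abs_of_nonneg (hw q)]
  · exact mul_le_mul_of_nonneg_left (hε q (Finset.mem_filter.1 hq).2) (hw q)
  · exact mul_le_mul_of_nonneg_left (hC q) (hw q)

/-- Final estimate for the averages: `A` is the weighted sum, `W` the total weight, `G` and `B` the
weights where the error is at most `ε / 2` and at most `C`. The bound `h1` also excludes `W = 0`. -/
theorem abs_div_sub_lt {A B C G W x ε : ℝ} (hsplit : G + B = W) (hB : 0 ≤ B) (hW0 : 0 ≤ W)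
    (hε : 0 < ε) (h1 : 1 / 2 < G / W) (h2 : (1 - G / W) * C < ε / 2)
    (key : |A - W * x| ≤ G * (ε / 2) + B * C) : |A / W - x| < ε := by
  have hW : 0 < W := by
    refine hW0.lt_of_ne fun h => ?_
    rw [← h, div_zero] at h1
    norm_num at h1
  have hBW : B * C < W * (ε / 2) := by
    have : (1 - G / W) * C = B * C / W := by
      field_simp
      rw [← hsplit]
      ring
    rw [this, div_lt_iff₀ hW] at h2
    linarith
  have hGW : G * (ε / 2) ≤ W * (ε / 2) := by
    gcongr
    linarith
  rw [show A / W - x = (A - W * x) / W by field_simp, abs_div, abs_of_pos hW, div_lt_iff₀ hW]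
  linarith

open Classical in
-- A Cesàro principle: boundedness controls the indices outside a cone `N ≤ q`, whose share of the
-- weight vanishes, and convergence controls those inside.
theorem tendsto_weighted_average {ι : Type*} [Preorder ι] [IsDirectedOrder ι] [Nonempty ι]
    {κ : Type*} {l : Filter κ} {a : ι → ℝ} {x C : ℝ}
    (ha : Tendsto a atTop (𝓝 x)) (hC : ∀ q, |a q - x| ≤ C)
    (S : κ → Finset ι) (w : ι → ℝ) (hw : ∀ q, 0 ≤ w q)
    (hS : ∀ N : ι, Tendsto (fun m => (∑ q ∈ S m with N ≤ q, w q) / ∑ q ∈ S m, w q) l (𝓝 1)) :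
    Tendsto (fun m => (∑ q ∈ S m, w q * a q) / ∑ q ∈ S m, w q) l (𝓝 x) := by
  rw [Metric.tendsto_nhds]
  intro ε hε
  have hev : ∀ᶠ q in atTop, dist (a q) x < ε / 2 := ha.eventually (Metric.ball_mem_nhds x (half_pos hε))
  obtain ⟨N, hN⟩ := eventually_atTop.1 hev
  have hC0 : 0 ≤ C := (abs_nonneg _).trans (hC N)
  have hlim : Tendsto (fun m => (1 - (∑ q ∈ S m with N ≤ q, w q) / ∑ q ∈ S m, w q) * C) l
      (𝓝 0) := by
    simpa using ((hS N).const_sub 1).mul_const C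
  filter_upwards [(hS N).eventually_const_lt (show (1 / 2 : ℝ) < 1 by norm_num),
    hlim.eventually_lt_const (half_pos hε)] with m hm1 hm2
  have key := abs_sum_weighted_le (S m) (N ≤ ·) hw (fun q hq => (hN q hq).le) hC
  have hsplit := Finset.sum_filter_add_sum_filter_not (S m) (N ≤ ·) w
  have hB : 0 ≤ ∑ q ∈ S m with ¬ N ≤ q, w q := Finset.sum_nonneg fun q _ => hw q
  have hW0 : 0 ≤ ∑ q ∈ S m, w q := Finset.sum_nonneg fun q _ => hw q
  have hrew : (∑ q ∈ S m, w q * (a q - x)) =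
      (∑ q ∈ S m, w q * a q) - (∑ q ∈ S m, w q) * x := by
    simp only [mul_sub, Finset.sum_sub_distrib, ← Finset.sum_mul]
  rw [hrew] at key
  rw [Real.dist_eq]
  exact abs_div_sub_lt hsplit hB hW0 hε hm1 hm2 key

end Averages

/-! ### Uniform averages over simplices -/

section Simplex

theorem mem_simplex {k m : ℕ} {q : Fin k → ℕ} : q ∈ simplex k m ↔ ∑ i, q i ≤ m := by
  simp only [simplex, Finset.mem_filter, Fintype.mem_piFinset, Finset.mem_range,
    Nat.lt_succ_iff, and_iff_right_iff_imp]
  exact fun h i => (Finset.single_le_sum (fun _ _ => Nat.zero_le _) (Finset.mem_univ i)).trans h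

/-- Fibre over the first coordinate and use the hockey-stick identity. -/
theorem card_simplex (k m : ℕ) : (simplex k m).card = (m + k).choose k := by
  induction k generalizing m with
  | zero =>
    have : simplex 0 m = Finset.univ := by ext q; simp [mem_simplex, eq_iff_true_of_subsingleton]
    simp [this]
  | succ k ih =>
    have h1 : (simplex (k + 1) m).card =
        ((Finset.range (m + 1)).sigma fun a => simplex k (m - a)).card := by
      refine Finset.card_bij' (fun q _ => ⟨q 0, Fin.tail q⟩) (fun p _ => Fin.cons p.1 p.2)
        ?_ ?_ ?_ ?_
      · intro q hq
        rw [mem_simplex, Fin.sum_univ_succ] at hq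
        simp only [Finset.mem_sigma, Finset.mem_range, mem_simplex, Fin.tail]
        omega
      · rintro ⟨a, q⟩ hp
        simp only [Finset.mem_sigma, Finset.mem_range, mem_simplex] at hp
        rw [mem_simplex, Fin.sum_univ_succ]
        simp only [Fin.cons_zero, Fin.cons_succ]
        omega
      · intro q _
        simp
      · rintro ⟨a, q⟩ _
        simp
    rw [h1, Finset.card_sigma]
    simp only [ih]
    have h2 := Finset.sum_range_reflect (fun a => (a + k).choose k) (m + 1)
    rw [Nat.sum_range_add_choose] at h2
    rw [show m + (k + 1) = m + k + 1 by ring, ← h2]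
    refine Finset.sum_congr rfl fun a _ => ?_
    rw [show m + 1 - 1 - a = m - a by omega]

open Classical in
-- Translation by `N` identifies a smaller simplex with the part of the large one above `N`.
theorem card_simplex_filter_le (k m : ℕ) (N : Fin k → ℕ) :
    ((simplex k (m + ∑ i, N i)).filter (N ≤ ·)).card = (m + k).choose k := by
  rw [← card_simplex]
  refine Finset.card_bij' (fun q _ => q - N) (fun q _ => q + N) ?_ ?_ ?_ ?_
  · intro q hq
    rw [Finset.mem_filter, mem_simplex] at hq
    rw [mem_simplex]
    have h : ∑ i, (q i - N i) + ∑ i, N i = ∑ i, q i := by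
      rw [← Finset.sum_add_distrib]
      exact Finset.sum_congr rfl fun i _ => Nat.sub_add_cancel (hq.2 i)
    simp only [Pi.sub_apply]
    omega
  · intro q hq
    rw [mem_simplex] at hq
    rw [Finset.mem_filter, mem_simplex]
    refine ⟨?_, fun i => by simp⟩
    simp only [Pi.add_apply, Finset.sum_add_distrib]
    omega
  · intro q hq
    exact funext fun i => Nat.sub_add_cancel ((Finset.mem_filter.1 hq).2 i)
  · intro q _
    simp

/-- The ratio telescopes into `c` factors, each a shift of `1 - k / (m + k + 1)`. -/
theorem tendsto_choose_ratio (k c : ℕ) :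
    Tendsto (fun m : ℕ => ((m + k).choose k : ℝ) / ((m + c + k).choose k : ℝ)) atTop (𝓝 1) := by
  have hpos : ∀ m : ℕ, (0 : ℝ) < ((m + k).choose k : ℝ) := fun m => by
    exact_mod_cast Nat.choose_pos (Nat.le_add_left k m)
  have step : Tendsto (fun m : ℕ => ((m + k).choose k : ℝ) / ((m + 1 + k).choose k : ℝ))
      atTop (𝓝 1) := by
    have h : ∀ m : ℕ, ((m + k).choose k : ℝ) / ((m + 1 + k).choose k : ℝ) =
        1 - (k : ℝ) / ((m : ℝ) + ((k : ℝ) + 1)) := by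
      intro m
      have h1 : (m + 1 + k).choose k * (m + 1) = (m + k).choose k * (m + 1 + k) := by
        have := Nat.choose_mul_succ_eq (m + k) k
        have e : m + k + 1 - k = m + 1 := by omega
        rw [e] at this
        rw [show m + 1 + k = m + k + 1 by ring, this.symm]
      have h2 : ((m + 1 + k).choose k : ℝ) * (m + 1) = (m + k).choose k * (m + 1 + k) := by
        exact_mod_cast h1
      have h3 := hpos (m + 1)
      have h4 : (0 : ℝ) < (m : ℝ) + (k + 1) := by positivity
      field_simp
      linarith
    simp only [h]
    have : Tendsto (fun m : ℕ => (k : ℝ) / ((m : ℝ) + ((k : ℝ) + 1))) atTop (𝓝 0) :=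
      Tendsto.div_atTop tendsto_const_nhds
        (tendsto_atTop_add_const_right _ _ tendsto_natCast_atTop_atTop)
    simpa using this.const_sub 1
  induction c with
  | zero =>
    refine tendsto_const_nhds.congr fun m => ?_
    rw [add_zero, div_self (hpos m).ne']
  | succ c ih =>
    have := ih.mul (step.comp (tendsto_add_atTop_nat c))
    rw [mul_one] at this
    refine this.congr fun m => ?_
    simp only [Function.comp_apply]
    rw [show m + (c + 1) + k = m + c + 1 + k by ring]
    exact div_mul_div_cancel₀ (hpos (m + c)).ne'

open Classical in
theorem tendsto_simplex_average {k : ℕ} {a : (Fin k → ℕ) → ℝ} {x C : ℝ}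
    (ha : Tendsto a atTop (𝓝 x)) (hC : ∀ q, |a q - x| ≤ C) :
    Tendsto (fun m : ℕ => (1 / ((m + k).choose k : ℝ)) * ∑ q ∈ simplex k m, a q)
      atTop (𝓝 x) := by
  have := tendsto_weighted_average (l := atTop) ha hC (simplex k) (fun _ => 1)
    (fun _ => zero_le_one) ?_
  · refine this.congr fun m => ?_
    simp only [one_mul, Finset.sum_const, card_simplex, nsmul_eq_mul, mul_one]
    ring
  · intro N
    rw [← tendsto_add_atTop_iff_nat (∑ i, N i)]
    refine (tendsto_choose_ratio k (∑ i, N i)).congr fun m => ?_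
    simp only [Finset.sum_const, card_simplex, nsmul_eq_mul, mul_one, card_simplex_filter_le]

end Simplex

/-! ### Geometrically weighted averages over boxes -/

section Boxes

variable {k : ℕ}

theorem sum_Iic_prod_pow (n : Fin k → ℕ) (q : Fin k → ℕ) :
    ∑ s ∈ Finset.Iic q, ∏ i, (n i : ℝ) ^ s i =
      ∏ i, ∑ r ∈ Finset.range (q i + 1), (n i : ℝ) ^ r := by
  rw [Finset.prod_univ_sum]
  refine Finset.sum_congr ?_ fun _ _ => rfl
  ext s
  simp [Pi.le_def]

open Classical in
theorem sum_Iic_filter_prod_pow (n : Fin k → ℕ) (q N : Fin k → ℕ) :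
    ∑ s ∈ (Finset.Iic q).filter (N ≤ ·), ∏ i, (n i : ℝ) ^ s i =
      ∏ i, ∑ r ∈ (Finset.range (q i + 1)).filter (N i ≤ ·), (n i : ℝ) ^ r := by
  rw [Finset.prod_univ_sum]
  refine Finset.sum_congr ?_ fun _ _ => rfl
  ext s
  simp [Pi.le_def, forall_and]

/-- The omitted head is a fixed number, while the full sum is at least `p + 1`; this covers `n = 1`
as well. -/
theorem tendsto_geom_tail_ratio {n : ℕ} (hn : 1 ≤ n) (N : ℕ) :
    Tendsto (fun p : ℕ => (∑ r ∈ (Finset.range (p + 1)).filter (N ≤ ·), (n : ℝ) ^ r) /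
      ∑ r ∈ Finset.range (p + 1), (n : ℝ) ^ r) atTop (𝓝 1) := by
  have hn' : (1 : ℝ) ≤ n := by exact_mod_cast hn
  have hlow : ∀ p : ℕ, (p : ℝ) + 1 ≤ ∑ r ∈ Finset.range (p + 1), (n : ℝ) ^ r := by
    intro p
    calc (p : ℝ) + 1 = ∑ r ∈ Finset.range (p + 1), (1 : ℝ) := by simp
      _ ≤ _ := Finset.sum_le_sum fun r _ => one_le_pow₀ hn'
  have hG : Tendsto (fun p : ℕ => ∑ r ∈ Finset.range (p + 1), (n : ℝ) ^ r) atTop atTop :=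
    tendsto_atTop_mono hlow (tendsto_atTop_add_const_right _ _ tendsto_natCast_atTop_atTop)
  have h0 : Tendsto (fun p : ℕ => (∑ r ∈ Finset.range N, (n : ℝ) ^ r) /
      ∑ r ∈ Finset.range (p + 1), (n : ℝ) ^ r) atTop (𝓝 0) :=
    Tendsto.div_atTop tendsto_const_nhds hG
  have h1 := h0.const_sub 1
  rw [sub_zero] at h1
  refine h1.congr' ?_
  filter_upwards [eventually_ge_atTop N] with p hp
  have hpos : 0 < ∑ r ∈ Finset.range (p + 1), (n : ℝ) ^ r :=
    lt_of_lt_of_le (by positivity) (hlow p)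
  have hs := Finset.sum_filter_add_sum_filter_not (Finset.range (p + 1)) (N ≤ ·)
    (fun r => (n : ℝ) ^ r)
  have he : (Finset.range (p + 1)).filter (fun r => ¬ N ≤ r) = Finset.range N := by
    ext r
    simp only [Finset.mem_filter, Finset.mem_range]
    omega
  rw [he] at hs
  field_simp
  linarith

open Classical in
-- Weights and boxes are products, so the share of a cone factors into one-dimensional tail ratios.
theorem tendsto_box_average {n : Fin k → ℕ} (hn : ∀ i, 1 ≤ n i) {a : (Fin k → ℕ) → ℝ} {x C : ℝ}
    (ha : Tendsto a atTop (𝓝 x)) (hC : ∀ q, |a q - x| ≤ C)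
    {κ : Type*} {l : Filter κ} {q : κ → Fin k → ℕ} (hq : Tendsto q l atTop) :
    Tendsto (fun m => (∑ s ∈ Finset.Iic (q m), (∏ i, (n i : ℝ) ^ s i) * a s) /
      ∏ i, ∑ r ∈ Finset.range (q m i + 1), (n i : ℝ) ^ r) l (𝓝 x) := by
  have := tendsto_weighted_average (l := l) ha hC (fun m => Finset.Iic (q m))
    (fun s => ∏ i, (n i : ℝ) ^ s i) (fun s => by positivity) ?_
  · simpa only [sum_Iic_prod_pow] using this
  · intro N
    simp only [sum_Iic_prod_pow, sum_Iic_filter_prod_pow, ← Finset.prod_div_distrib]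
    rw [← Finset.prod_const_one (M := ℝ) (s := (Finset.univ : Finset (Fin k)))]
    refine tendsto_finsetProd _ fun i _ => ?_
    refine (tendsto_geom_tail_ratio (hn i) (N i)).comp (f := fun m => q m i) ?_
    exact (tendsto_atTop_atTop.2 fun b => ⟨fun _ => b, fun a ha => ha i⟩ :
      Tendsto (fun r : Fin k → ℕ => r i) atTop atTop).comp hq

end Boxes

/-! ### Trace of a finite rank projection -/

section Trace

variable {E : Type*} [NormedAddCommGroup E] [InnerProductSpace ℂ E] [CompleteSpace E]

omit [CompleteSpace E] in
theorem tsum_norm_inner_sq {ι : Type*} (b : HilbertBasis ι ℂ E) (x : E) :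
    ∑' i, ENNReal.ofReal (‖⟪b i, x⟫_ℂ‖ ^ 2) = ENNReal.ofReal (‖x‖ ^ 2) := by
  have h : HasSum (fun i => ‖⟪b i, x⟫_ℂ‖ ^ 2) (‖x‖ ^ 2) := by
    have h1 := b.hasSum_inner_mul_inner x x
    rw [inner_self_eq_norm_sq_to_K] at h1
    have h2 := Complex.hasSum_re h1
    convert h2 using 1
    · ext i
      rw [← RCLike.re_eq_complex_re, inner_mul_symm_re_eq_norm, norm_mul, sq, norm_inner_symm]
    · norm_cast
  rw [← h.tsum_eq, ENNReal.ofReal_tsum_of_nonneg (fun _ => by positivity) h.summable]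

/-- Expand the projection in an orthonormal basis of `V`, exchange the sums, and apply Parseval to
each unit vector. -/
theorem opTrace_starProjection (V : Submodule ℂ E) [FiniteDimensional ℂ V] :
    opTrace V.starProjection = Module.finrank ℂ V := by
  obtain ⟨b, hb⟩ := (exists_hilbertBasis ℂ E).choose_spec
  let e := stdOrthonormalBasis ℂ V
  have h1 : ∀ x : E, ENNReal.ofReal (RCLike.re ⟪x, V.starProjection x⟫_ℂ) =
      ∑ a, ENNReal.ofReal (‖⟪x, (e a : E)⟫_ℂ‖ ^ 2) := by
    intro x
    rw [← ENNReal.ofReal_sum_of_nonneg (fun _ _ => by positivity), e.starProjection_eq_sum_rankOne]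
    congr 1
    simp only [sum_apply, inner_sum, map_sum,
      InnerProductSpace.rankOne_apply, inner_smul_right]
    refine Finset.sum_congr rfl fun a _ => ?_
    rw [inner_mul_symm_re_eq_norm, norm_mul, sq, norm_inner_symm]
  simp only [opTrace, h1]
  rw [Summable.tsum_finsetSum (fun _ _ => ENNReal.summable)]
  have h2 : ∀ a, ∑' v : (exists_hilbertBasis ℂ E).choose,
      ENNReal.ofReal (‖⟪(v : E), (e a : E)⟫_ℂ‖ ^ 2) = 1 := by
    intro a
    have := tsum_norm_inner_sq b (e a : E)
    rw [hb] at this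
    rw [this]
    have hn : ‖(e a : E)‖ = 1 := e.norm_eq_one a
    simp [hn]
  simp only [h2]
  simp

end Trace

/-! ### Counting words -/

section Words

/-- The words of length `p` in `m` letters. -/
def wordsOfLength (m : ℕ) : ℕ → Finset (List (Fin m))
  | 0 => {[]}
  | p + 1 => (Finset.univ ×ˢ wordsOfLength m p).map
      ⟨fun x => x.1 :: x.2, fun x y h => by
        simp only [List.cons.injEq] at h
        exact Prod.ext h.1 h.2⟩

theorem mem_wordsOfLength {m p : ℕ} {w : List (Fin m)} :
    w ∈ wordsOfLength m p ↔ w.length = p := by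
  induction p generalizing w with
  | zero => simp [wordsOfLength]
  | succ p ih =>
    cases w with
    | nil => simp [wordsOfLength]
    | cons a w =>
      simp only [wordsOfLength, Finset.mem_map, Finset.mem_product, Finset.mem_univ, true_and, ih,
        Prod.exists, List.length_cons, Nat.add_right_cancel_iff]
      exact ⟨fun ⟨b, v, h1, h2⟩ => (List.cons.inj h2).2 ▸ h1, fun h => ⟨a, w, h, rfl⟩⟩

theorem sum_wordsOfLength_succ {M : Type*} [AddCommMonoid M] (m p : ℕ) (f : List (Fin m) → M) :
    ∑ w ∈ wordsOfLength m (p + 1), f w = ∑ j, ∑ w ∈ wordsOfLength m p, f (j :: w) := by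
  rw [wordsOfLength, Finset.sum_map, Finset.sum_product]
  rfl

theorem card_wordsOfLength (m p : ℕ) : (wordsOfLength m p).card = m ^ p := by
  induction p with
  | zero => simp [wordsOfLength]
  | succ p ih => simp [wordsOfLength, ih, pow_succ']

variable {k : ℕ} (n : Fin k → ℕ)

/-- The multi-words of length `q`. -/
def multiWordsOfLength (q : Fin k → ℕ) : Finset (MultiWord n) :=
  Fintype.piFinset fun i => wordsOfLength (n i) (q i)

variable {n}

theorem mem_multiWordsOfLength {q : Fin k → ℕ} {β : MultiWord n} :
    β ∈ multiWordsOfLength n q ↔ ∀ i, (β i).length = q i := by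
  simp [multiWordsOfLength, mem_wordsOfLength]

theorem card_multiWordsOfLength (q : Fin k → ℕ) :
    (multiWordsOfLength n q).card = ∏ i, n i ^ q i := by
  simp [multiWordsOfLength, card_wordsOfLength]

end Words

/-! ### Levels of the Fock space and their projections -/

section Fock

variable {k : ℕ} {n : Fin k → ℕ}

/-- Coordinates on the `q`-th level of the tensor product of Fock spaces. -/
def fockLevelCoord (q : Fin k → ℕ) :
    fockLevel n ℂ q →ₗ[ℂ] (multiWordsOfLength n q → ℂ) where
  toFun f β := (f : FockTensor n ℂ) β
  map_add' _ _ := rfl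
  map_smul' _ _ := rfl

theorem fockLevelCoord_bijective (q : Fin k → ℕ) :
    Function.Bijective (fockLevelCoord (n := n) q) := by
  classical
  constructor
  · rw [← LinearMap.ker_eq_bot, LinearMap.ker_eq_bot']
    intro f hf
    ext β
    by_cases hβ : β ∈ multiWordsOfLength n q
    · exact congrFun hf ⟨β, hβ⟩
    · rw [mem_multiWordsOfLength] at hβ
      exact f.2 β hβ
  · intro g
    have hmem : ∀ β : multiWordsOfLength n q,
        (lp.single 2 (β : MultiWord n) (g β) : FockTensor n ℂ) ∈ fockLevel n ℂ q := by
      intro β γ hγ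
      refine lp.single_apply_ne 2 _ _ ?_
      rintro rfl
      exact hγ (mem_multiWordsOfLength.1 β.2)
    refine ⟨∑ β, ⟨_, hmem β⟩, ?_⟩
    ext γ
    rw [map_sum, Finset.sum_apply, Finset.sum_eq_single γ]
    · exact lp.single_apply_self 2 _ _
    · intro β _ hβ
      exact lp.single_apply_ne 2 _ _ fun h => hβ (Subtype.ext h.symm)
    · simp

instance (q : Fin k → ℕ) : FiniteDimensional ℂ (fockLevel n ℂ q) :=
  (LinearEquiv.ofBijective _ (fockLevelCoord_bijective q)).symm.finiteDimensional

theorem finrank_fockLevel (q : Fin k → ℕ) :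
    Module.finrank ℂ (fockLevel n ℂ q) = ∏ i, n i ^ q i := by
  rw [(LinearEquiv.ofBijective _ (fockLevelCoord_bijective (n := n) q)).finrank_eq,
    Module.finrank_fintype_fun_eq_card, Fintype.card_coe, card_multiWordsOfLength]

theorem opTrace_fockProj (q : Fin k → ℕ) :
    (opTrace (fockProj n ℂ q)).toReal = ∏ i, (n i : ℝ) ^ q i := by
  rw [fockProj, opTrace_starProjection, finrank_fockLevel]
  simp

/-- For `β` in the level, `f - P f` is orthogonal to the vectors supported at `β`. -/
theorem fockProj_apply {D : Type*} [NormedAddCommGroup D] [InnerProductSpace ℂ D]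
    [CompleteSpace D] (q : Fin k → ℕ) (f : FockTensor n D) (β : MultiWord n) :
    fockProj n D q f β = if β ∈ multiWordsOfLength n q then f β else 0 := by
  classical
  split_ifs with hβ
  · have h1 : ⟪f - fockProj n D q f, lp.single 2 β (f β - fockProj n D q f β)⟫_ℂ = 0 := by
      refine Submodule.starProjection_inner_eq_zero f _ fun γ hγ => ?_
      refine lp.single_apply_ne 2 _ _ ?_
      rintro rfl
      exact hγ (mem_multiWordsOfLength.1 hβ)
    rw [lp.inner_single_right, lp.coeFn_sub, Pi.sub_apply, inner_self_eq_zero, sub_eq_zero] at h1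
    exact h1.symm
  · rw [mem_multiWordsOfLength] at hβ
    exact Submodule.starProjection_apply_mem (fockLevel n D q) f β hβ

end Fock

/-! ### Iterated completely positive maps as sums over words -/

section OperatorSums

variable {H : Type*} [NormedAddCommGroup H] [InnerProductSpace ℂ H] [CompleteSpace H]

theorem cpMap_pow_apply {k : ℕ} {n : Fin k → ℕ} (T : OpTuple n H) (i : Fin k) (p : ℕ)
    (Y : H →L[ℂ] H) :
    ((cpMap T i) ^ p) Y = ∑ w ∈ wordsOfLength (n i) p, wordOp T i w * Y * star (wordOp T i w) := by
  induction p with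
  | zero => simp [wordsOfLength, wordOp]
  | succ p ih =>
    rw [pow_succ', Module.End.mul_apply, ih, sum_wordsOfLength_succ]
    change ∑ j, T i j * _ * star (T i j) = _
    refine Finset.sum_congr rfl fun j _ => ?_
    simp only [wordOp, List.map_cons, List.prod_cons, star_mul, Finset.mul_sum, Finset.sum_mul,
      mul_assoc]

/-- Stated for arbitrary finite families of operators so that the induction on `k` can drop the
first index. -/
theorem sum_piFinset_prod_conj {k : ℕ} {α : Fin k → Type*} (W : (i : Fin k) → Finset (α i))
    (A : (i : Fin k) → α i → (H →L[ℂ] H)) (Ψ : Fin k → Module.End ℂ (H →L[ℂ] H))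
    (hΨ : ∀ i Y, Ψ i Y = ∑ w ∈ W i, A i w * Y * star (A i w)) (Y : H →L[ℂ] H) :
    (List.ofFn Ψ).prod Y = ∑ β ∈ Fintype.piFinset W,
      (List.ofFn fun i => A i (β i)).prod * Y * star (List.ofFn fun i => A i (β i)).prod := by
  induction k with
  | zero => simp
  | succ k ih =>
    rw [List.ofFn_succ, List.prod_cons, Module.End.mul_apply, hΨ,
      ih (fun i => W i.succ) (fun i => A i.succ) (fun i => Ψ i.succ) fun i => hΨ i.succ]
    simp only [Finset.mul_sum, Finset.sum_mul]
    rw [← Finset.sum_product']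
    refine Finset.sum_bij' (fun p _ => Fin.cons p.1 p.2) (fun β _ => (β 0, Fin.tail β))
      ?_ ?_ ?_ ?_ ?_
    · intro p hp
      simp only [Finset.mem_product, Fintype.mem_piFinset] at hp ⊢
      exact Fin.cases hp.1 hp.2
    · intro β hβ
      simp only [Finset.mem_product, Fintype.mem_piFinset] at hβ ⊢
      exact ⟨hβ 0, fun i => hβ i.succ⟩
    · intro p _
      simp
    · intro β _
      simp
    · intro p _
      simp only [List.ofFn_succ, List.prod_cons, Fin.cons_zero, Fin.cons_succ, star_mul, mul_assoc]

theorem sum_multiWordsOfLength {k : ℕ} {n : Fin k → ℕ} (T : OpTuple n H) (q : Fin k → ℕ)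
    (Y : H →L[ℂ] H) :
    (List.ofFn fun i => (cpMap T i) ^ q i).prod Y =
      ∑ β ∈ multiWordsOfLength n q, multiWordOp T β * Y * star (multiWordOp T β) :=
  sum_piFinset_prod_conj _ (fun i w => wordOp T i w) _ (fun i Y => cpMap_pow_apply T i (q i) Y) Y

end OperatorSums

/-! ### Graded row-coisometric shifts -/

section GradedShift

variable {E : Type*} [NormedAddCommGroup E] [InnerProductSpace ℂ E] [CompleteSpace E]
variable {k : ℕ} {n : Fin k → ℕ}

/-- The tuple `R` acts as a graded row-coisometric shift on the Hilbert direct sum of the finite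
dimensional spaces `V q`, `q ∈ ℕ^k`. -/
structure IsGradedShift (R : OpTuple n E) (V : (Fin k → ℕ) → Submodule ℂ E) : Prop where
  finite (q) : FiniteDimensional ℂ (V q)
  ortho (q r) : q ≠ r → ∀ x ∈ V q, ∀ y ∈ V r, ⟪x, y⟫_ℂ = 0
  total (y : E) : (∀ q, ∀ x ∈ V q, ⟪x, y⟫_ℂ = 0) → y = 0
  commute : ∀ s t : Fin k, s ≠ t → ∀ (i : Fin (n s)) (j : Fin (n t)), Commute (R s i) (R t j)
  map_mem (q : Fin k → ℕ) (i j) : ∀ x ∈ V q, R i j x ∈ V (q + Pi.single i 1)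
  adj_mem (q : Fin k → ℕ) (i j) : ∀ x ∈ V (q + Pi.single i 1), star (R i j) x ∈ V q
  adj_zero (q : Fin k → ℕ) (i j) : q i = 0 → ∀ x ∈ V q, star (R i j) x = 0
  sum_eq (q : Fin k → ℕ) (i) : ∀ x ∈ V (q + Pi.single i 1), ∑ j, R i j (star (R i j) x) = x

/-- The operator `Y` is multiplication by the scalar `φ q` on `V q`, for every `q`. -/
def IsDiagonal (V : (Fin k → ℕ) → Submodule ℂ E) (Y : E →L[ℂ] E) (φ : (Fin k → ℕ) → ℂ) : Prop :=
  ∀ q, ∀ x ∈ V q, Y x = φ q • x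

variable {R : OpTuple n E} {V : (Fin k → ℕ) → Submodule ℂ E}

namespace IsGradedShift

theorem hom_ext (hR : IsGradedShift R V) {A B : E →L[ℂ] E}
    (h : ∀ q, ∀ x ∈ V q, A x = B x) : A = B := by
  have h0 : star (A - B) = 0 := by
    ext y
    refine hR.total _ fun q x hx => ?_
    rw [ContinuousLinearMap.star_eq_adjoint, ContinuousLinearMap.adjoint_inner_right, sub_apply,
      h q x hx, sub_self, inner_zero_left]
  rwa [star_eq_zero, sub_eq_zero] at h0

/-- `R_{i,j}^*` lowers the degree by `e_i`, `Y` is scalar there, and coisometry reassembles `x`; on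
the face `q i = 0` all adjoints vanish. -/
theorem isDiagonal_cpMap (hR : IsGradedShift R V) {Y : E →L[ℂ] E} {φ : (Fin k → ℕ) → ℂ}
    (hY : IsDiagonal V Y φ) (i : Fin k) :
    IsDiagonal V (cpMap R i Y) fun q => if q i = 0 then 0 else φ (q - Pi.single i 1) := by
  intro q x hx
  have e : cpMap R i Y x = ∑ j, R i j (Y (star (R i j) x)) := by
    change (∑ j, R i j * Y * star (R i j)) x = _
    rw [sum_apply]
    rfl
  rw [e]
  dsimp only
  split_ifs with h0
  · simp [hR.adj_zero q i _ h0 x hx]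
  · have hq : q = (q - Pi.single i 1) + Pi.single i 1 := by
      refine (tsub_add_cancel_of_le ?_).symm
      intro j
      by_cases hj : j = i
      · subst hj
        simp only [Pi.single_eq_same]
        omega
      · simp [hj]
    rw [hq] at hx
    have hsum := hR.sum_eq _ i x hx
    conv_rhs => rw [← hsum, Finset.smul_sum]
    refine Finset.sum_congr rfl fun j _ => ?_
    rw [hY _ _ (hR.adj_mem _ i j x hx), map_smul]

theorem isDiagonal_cpMap_pow (hR : IsGradedShift R V) {Y : E →L[ℂ] E} {φ : (Fin k → ℕ) → ℂ}
    (hY : IsDiagonal V Y φ) (i : Fin k) (p : ℕ) :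
    IsDiagonal V (((cpMap R i) ^ p) Y)
      fun q => if p ≤ q i then φ (q - Pi.single i p) else 0 := by
  induction p with
  | zero => simpa using hY
  | succ p ih =>
    rw [pow_succ', Module.End.mul_apply]
    convert hR.isDiagonal_cpMap ih i using 2 with q
    by_cases h0 : q i = 0
    · simp [h0]
    · rw [if_neg h0, tsub_tsub, ← Pi.single_add, add_comm 1 p]
      refine if_congr ?_ rfl rfl
      simp only [Pi.sub_apply, Pi.single_eq_same]
      omega

/-- Each factor with `p i = 1` subtracts the translate by `e_i` of an indicator not depending on
coordinate `i`, leaving the face `q i = 0`. Distinct indices in `l` guarantee that independence. -/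
theorem isDiagonal_defect_list (hR : IsGradedShift R V) {p : Fin k → ℕ} (hp : ∀ i, p i ≤ 1)
    {l : List (Fin k)} (hl : l.Nodup) :
    IsDiagonal V ((l.map fun i => (1 - cpMap R i) ^ p i).prod 1)
      fun q => if ∀ i ∈ l, p i = 1 → q i = 0 then 1 else 0 := by
  induction l with
  | nil => intro q x _; simp
  | cons i l ih =>
    rw [List.nodup_cons] at hl
    have ih := ih hl.2
    rw [List.map_cons, List.prod_cons, Module.End.mul_apply]
    rcases Nat.le_one_iff_eq_zero_or_eq_one.1 (hp i) with h0 | h1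
    · simpa [h0] using ih
    · intro q x hx
      rw [h1, pow_one, LinearMap.sub_apply, Module.End.one_apply, sub_apply, ih q x hx,
        hR.isDiagonal_cpMap ih i q x hx, ← sub_smul]
      congr 1
      have hshift : (∀ j ∈ l, p j = 1 → (q - Pi.single i 1 : Fin k → ℕ) j = 0) ↔
          ∀ j ∈ l, p j = 1 → q j = 0 := by
        refine forall₂_congr fun j hj => ?_
        have hji : j ≠ i := fun h => hl.1 (h ▸ hj)
        simp [hji]
      simp only [hshift, List.forall_mem_cons, h1, forall_true_left]
      by_cases hq : q i = 0 <;> simp [hq]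

theorem isDiagonal_star (hR : IsGradedShift R V) {Y : E →L[ℂ] E} {φ : (Fin k → ℕ) → ℂ}
    (hY : IsDiagonal V Y φ) : IsDiagonal V (star Y) fun q => star (φ q) := by
  intro q x hx
  rw [← sub_eq_zero]
  refine hR.total _ fun r y hy => ?_
  rw [inner_sub_right, ContinuousLinearMap.star_eq_adjoint,
    ContinuousLinearMap.adjoint_inner_right, hY r y hy, inner_smul_left, inner_smul_right]
  by_cases hrq : r = q
  · subst hrq
    simp
  · simp [hR.ortho r q hrq y hy x hx]

theorem isStarProjection (hR : IsGradedShift R V) {Y : E →L[ℂ] E} {φ : (Fin k → ℕ) → ℂ}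
    (hY : IsDiagonal V Y φ) (hφ : ∀ q, φ q = 0 ∨ φ q = 1) : IsStarProjection Y where
  isIdempotentElem := hR.hom_ext fun q x hx => by
    rw [mul_apply_eq_comp, hY q x hx, map_smul, hY q x hx]
    rcases hφ q with h | h <;> simp [h]
  isSelfAdjoint := hR.hom_ext fun q x hx => by
    rw [hR.isDiagonal_star hY q x hx, hY q x hx]
    rcases hφ q with h | h <;> simp [h]

theorem memPolyball (hR : IsGradedShift R V) : MemPolyball R where
  commute := hR.commute
  isPositive p hp := by
    have h := hR.isDiagonal_defect_list hp (List.nodup_finRange k)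
    rw [← List.ofFn_eq_map] at h
    refine ContinuousLinearMap.IsPositive.of_isStarProjection (hR.isStarProjection h fun q => ?_)
    exact (ite_eq_or_eq _ _ _).symm

theorem isDiagonal_starProjection (hR : IsGradedShift R V) (p : Fin k → ℕ)
    [FiniteDimensional ℂ (V p)] :
    IsDiagonal V (V p).starProjection fun q => if q = p then 1 else 0 := by
  intro q x hx
  dsimp only
  by_cases hq : q = p
  · subst hq
    rw [if_pos rfl, one_smul, Submodule.starProjection_eq_self_iff.2 hx]
  · rw [if_neg hq, zero_smul, Submodule.starProjection_apply_eq_zero_iff,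
      Submodule.mem_orthogonal]
    exact fun y hy => hR.ortho p q (Ne.symm hq) y hy x hx

theorem eq_starProjection (hR : IsGradedShift R V) {Y : E →L[ℂ] E} (p : Fin k → ℕ)
    [FiniteDimensional ℂ (V p)]
    (hY : IsDiagonal V Y fun q => if q = p then 1 else 0) : Y = (V p).starProjection := by
  refine hR.hom_ext fun q x hx => ?_
  rw [hY q x hx, hR.isDiagonal_starProjection p q x hx]

theorem defect_eq (hR : IsGradedShift R V) [FiniteDimensional ℂ (V 0)] :
    defect R = (V 0).starProjection := by
  refine hR.eq_starProjection 0 ?_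
  have h := hR.isDiagonal_defect_list (p := fun _ => 1) (fun _ => le_rfl) (List.nodup_finRange k)
  rw [← List.ofFn_eq_map] at h
  intro q x hx
  refine (h q x hx).trans ?_
  congr 1
  exact if_congr (by simp [funext_iff]) rfl rfl

theorem range_defect (hR : IsGradedShift R V) : (defect R).range = V 0 := by
  have := hR.finite 0
  rw [hR.defect_eq]
  exact Submodule.range_starProjection _

theorem hasFiniteRank (hR : IsGradedShift R V) : HasFiniteRank R := by
  rw [HasFiniteRank, hR.range_defect]
  exact hR.finite 0

/-- Starting from the indicator of the origin, each factor translates the symbol by `p i` in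
coordinate `i`. -/
theorem isDiagonal_level_list (hR : IsGradedShift R V) (p : Fin k → ℕ)
    {l : List (Fin k)} (hl : l.Nodup) :
    IsDiagonal V ((l.map fun i => (cpMap R i) ^ p i).prod (defect R))
      fun q => if ∀ j, q j = if j ∈ l then p j else 0 then 1 else 0 := by
  have := hR.finite 0
  induction l with
  | nil =>
    convert hR.isDiagonal_starProjection 0 using 3 with q
    · simpa using hR.defect_eq
    · simp [funext_iff]
  | cons i l ih =>
    rw [List.nodup_cons] at hl
    rw [List.map_cons, List.prod_cons, Module.End.mul_apply]
    convert hR.isDiagonal_cpMap_pow (ih hl.2) i (p i) using 2 with q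
    by_cases hq : p i ≤ q i
    · rw [if_pos hq]
      refine if_congr (forall_congr' fun j => ?_) rfl rfl
      by_cases hj : j = i
      · subst hj
        simp [hl.1]
        omega
      · simp [hj]
    · rw [if_neg hq, if_neg]
      intro h
      have := h i
      simp at this
      omega

theorem sum_conj_defect (hR : IsGradedShift R V) (p : Fin k → ℕ) [FiniteDimensional ℂ (V p)] :
    ∑ β ∈ multiWordsOfLength n p, multiWordOp R β * defect R * star (multiWordOp R β) =
      (V p).starProjection := by
  rw [← sum_multiWordsOfLength]
  refine hR.eq_starProjection p ?_
  have h := hR.isDiagonal_level_list p (List.nodup_finRange k)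
  rw [← List.ofFn_eq_map] at h
  intro q x hx
  refine (h q x hx).trans ?_
  congr 1
  exact if_congr (by simp [funext_iff]) rfl rfl

/-- By coisometry, `x` is recovered from its images under the `n i` adjoints, all of which lie in `V
q`. -/
theorem finrank_succ_le (hR : IsGradedShift R V) (q : Fin k → ℕ) (i : Fin k) :
    Module.finrank ℂ (V (q + Pi.single i 1)) ≤ n i * Module.finrank ℂ (V q) := by
  have := hR.finite q
  have := hR.finite (q + Pi.single i 1)
  let f : V (q + Pi.single i 1) →ₗ[ℂ] (Fin (n i) → V q) :=
    LinearMap.pi fun j =>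
      (((star (R i j) : E →L[ℂ] E) : E →ₗ[ℂ] E).domRestrict _).codRestrict (V q)
        fun x => hR.adj_mem q i j x x.2
  have hf : Function.Injective f := by
    rw [← LinearMap.ker_eq_bot, LinearMap.ker_eq_bot']
    intro x hx
    have h1 : ∀ j, star (R i j) (x : E) = 0 := fun j => congrArg Subtype.val (congrFun hx j)
    have h2 := hR.sum_eq q i x x.2
    simp only [h1, map_zero, Finset.sum_const_zero] at h2
    exact Subtype.ext h2.symm
  refine (LinearMap.finrank_le_finrank_of_injective hf).trans ?_
  rw [Module.finrank_pi_fintype]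
  simp

end IsGradedShift

/-- The normalized dimensions `dim V_q / ∏_i n_i^{q_i}`. -/
noncomputable def dimRatio (n : Fin k → ℕ) (V : (Fin k → ℕ) → Submodule ℂ E) (q : Fin k → ℕ) : ℝ :=
  (Module.finrank ℂ (V q) : ℝ) / ∏ i, (n i : ℝ) ^ q i

omit [CompleteSpace E] in
theorem dimRatio_nonneg (q : Fin k → ℕ) : 0 ≤ dimRatio n V q := by
  unfold dimRatio
  positivity

namespace IsGradedShift

theorem dimRatio_succ_le (hR : IsGradedShift R V) (hn : ∀ i, 1 ≤ n i) (q : Fin k → ℕ)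
    (i : Fin k) : dimRatio n V (q + Pi.single i 1) ≤ dimRatio n V q := by
  have hpos : ∀ r : Fin k → ℕ, (0 : ℝ) < ∏ i, (n i : ℝ) ^ r i := fun r =>
    Finset.prod_pos fun i _ => pow_pos (by exact_mod_cast hn i) _
  have hprod : ∏ j, (n j : ℝ) ^ (q + Pi.single i 1 : Fin k → ℕ) j =
      n i * ∏ j, (n j : ℝ) ^ q j := by
    simp only [Pi.add_apply, pow_add, Finset.prod_mul_distrib]
    rw [mul_comm]
    congr 1
    rw [Finset.prod_eq_single i] <;> simp +contextual
  have h : (Module.finrank ℂ (V (q + Pi.single i 1)) : ℝ) ≤ n i * Module.finrank ℂ (V q) := by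
    exact_mod_cast hR.finrank_succ_le q i
  unfold dimRatio
  rw [hprod, div_le_div_iff₀ (mul_pos (by exact_mod_cast hn i) (hpos q)) (hpos q)]
  calc _ ≤ (n i * Module.finrank ℂ (V q) : ℝ) * ∏ j, (n j : ℝ) ^ q j := by
        gcongr
    _ = _ := by ring

/-- Go from `q` to `r` by unit steps, by induction on the number of steps. -/
theorem antitone_dimRatio (hR : IsGradedShift R V) (hn : ∀ i, 1 ≤ n i) :
    Antitone (dimRatio n V) := by
  have key : ∀ (N : ℕ) (q s : Fin k → ℕ), ∑ i, s i = N → dimRatio n V (q + s) ≤ dimRatio n V q := by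
    intro N
    induction N with
    | zero =>
      intro q s hs
      have : s = 0 := funext fun i => Finset.sum_eq_zero_iff.1 hs i (Finset.mem_univ i)
      rw [this, add_zero]
    | succ N ih =>
      intro q s hs
      obtain ⟨i, hi⟩ : ∃ i, s i ≠ 0 := by
        by_contra! h
        simp [h] at hs
      have hle : Pi.single i 1 ≤ s := by
        intro j
        by_cases hj : j = i
        · subst hj
          simp only [Pi.single_eq_same]
          omega
        · simp [hj]
      have hs' : s = (s - Pi.single i 1) + Pi.single i 1 := (tsub_add_cancel_of_le hle).symm
      have hN : ∑ j, (s - Pi.single i 1 : Fin k → ℕ) j = N := by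
        rw [hs'] at hs
        simp only [Pi.add_apply, Finset.sum_add_distrib, Finset.sum_pi_single', Finset.mem_univ,
          if_true] at hs
        simpa using hs
      rw [hs', ← add_assoc]
      exact (hR.dimRatio_succ_le hn _ i).trans (ih q _ hN)
  intro q r hqr
  have := key _ q (r - q) rfl
  rwa [add_tsub_cancel_of_le hqr] at this

theorem exists_tendsto_dimRatio (hR : IsGradedShift R V) (hn : ∀ i, 1 ≤ n i) :
    ∃ x C : ℝ, Tendsto (dimRatio n V) atTop (𝓝 x) ∧ ∀ q, |dimRatio n V q - x| ≤ C := by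
  refine ⟨⨅ q, dimRatio n V q, dimRatio n V 0 + |⨅ q, dimRatio n V q|,
    tendsto_atTop_ciInf (hR.antitone_dimRatio hn) ⟨0, ?_⟩, fun q => ?_⟩
  · rintro _ ⟨q, rfl⟩
    exact dimRatio_nonneg q
  · refine (abs_sub _ _).trans ?_
    rw [abs_of_nonneg (dimRatio_nonneg q)]
    gcongr
    exact hR.antitone_dimRatio hn zero_le

end IsGradedShift

end GradedShift

/-! ### Berezin kernel, curvature and Euler characteristic of a graded shift -/

section Berezin

variable {E : Type*} [NormedAddCommGroup E] [InnerProductSpace ℂ E] [CompleteSpace E]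
variable {k : ℕ} {n : Fin k → ℕ}
variable {R : OpTuple n E} {V : (Fin k → ℕ) → Submodule ℂ E}

omit [CompleteSpace E] in
theorem commute_wordOp {i j : Fin k} (h : ∀ a b, Commute (R i a) (R j b)) (v : List (Fin (n i)))
    (w : List (Fin (n j))) : Commute (wordOp R i v) (wordOp R j w) := by
  refine Commute.list_prod_left _ _ fun x hx => Commute.list_prod_right _ _ fun y hy => ?_
  obtain ⟨a, _, rfl⟩ := List.mem_map.1 hx
  obtain ⟨b, _, rfl⟩ := List.mem_map.1 hy
  exact h a b

theorem star_list_prod {M : Type*} [Monoid M] [StarMul M] (l : List M) :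
    star l.prod = (l.map star).reverse.prod := by
  induction l with
  | nil => simp
  | cons a l ih => simp [ih]

/-- Taking adjoints reverses the order of the `k` blocks; blocks with different indices commute, so
the order can be restored. -/
theorem star_multiWordOp
    (hR : ∀ s t : Fin k, s ≠ t → ∀ (i : Fin (n s)) (j : Fin (n t)), Commute (R s i) (R t j))
    (β : MultiWord n) :
    star (multiWordOp R β) = (List.ofFn fun i => star (wordOp R i (β i))).prod := by
  have h1 : (List.ofFn fun i => wordOp R i (β i)).reverse.prod =
      (List.ofFn fun i => wordOp R i (β i)).prod := by
    refine (List.Perm.prod_eq' (List.reverse_perm _).symm ?_).symm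
    rw [List.pairwise_ofFn]
    exact fun i j hij => commute_wordOp (hR i j hij.ne) _ _
  rw [multiWordOp, ← h1, star_list_prod, List.map_reverse, List.reverse_reverse, List.map_ofFn]
  rfl

namespace IsGradedShift

theorem defect_isSelfAdjoint (hR : IsGradedShift R V) : star (defect R) = defect R := by
  have := hR.finite 0
  rw [hR.defect_eq]
  exact isSelfAdjoint_starProjection _

theorem defect_mul_self (hR : IsGradedShift R V) : defect R * defect R = defect R := by
  have := hR.finite 0
  rw [hR.defect_eq]
  exact (V 0).isIdempotentElem_starProjection

theorem sqrt_defect (hR : IsGradedShift R V) : CFC.sqrt (defect R) = defect R := by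
  have := hR.finite 0
  refine CFC.sqrt_unique hR.defect_mul_self ?_
  rw [ContinuousLinearMap.nonneg_iff_isPositive, hR.defect_eq]
  exact ContinuousLinearMap.IsPositive.of_isStarProjection isStarProjection_starProjection

theorem sum_inner_defect (hR : IsGradedShift R V) (q : Fin k → ℕ) [FiniteDimensional ℂ (V q)]
    (x y : E) :
    ∑ β ∈ multiWordsOfLength n q, ⟪defect R (star (multiWordOp R β) x),
      defect R (star (multiWordOp R β) y)⟫_ℂ = ⟪x, (V q).starProjection y⟫_ℂ := by
  rw [← hR.sum_conj_defect q, sum_apply, inner_sum]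
  refine Finset.sum_congr rfl fun β _ => ?_
  rw [← ContinuousLinearMap.adjoint_inner_right, ← ContinuousLinearMap.star_eq_adjoint,
    hR.defect_isSelfAdjoint, ContinuousLinearMap.star_eq_adjoint (multiWordOp R β),
    ContinuousLinearMap.adjoint_inner_left, ← ContinuousLinearMap.star_eq_adjoint,
    ← mul_apply_eq_comp (defect R) (defect R), hR.defect_mul_self]
  rfl

/-- Bessel's inequality: the finite sum has a `0`-`1` symbol, so it is itself a projection. -/
theorem sum_re_inner_starProjection_le (hR : IsGradedShift R V)
    [∀ q, FiniteDimensional ℂ (V q)] (Q : Finset (Fin k → ℕ)) (x : E) :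
    ∑ q ∈ Q, RCLike.re ⟪x, (V q).starProjection x⟫_ℂ ≤ ‖x‖ ^ 2 := by
  classical
  have hdiag : IsDiagonal V (∑ q ∈ Q, (V q).starProjection) fun q => if q ∈ Q then 1 else 0 := by
    intro r y hy
    rw [sum_apply]
    simp only [hR.isDiagonal_starProjection _ r y hy, ← Finset.sum_smul, Finset.sum_ite_eq]
  have hproj := hR.isStarProjection hdiag fun q => (ite_eq_or_eq _ _ _).symm
  have hpos := ContinuousLinearMap.IsPositive.of_isStarProjection hproj.one_sub
  have h1 := hpos.re_inner_nonneg_right x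
  rw [sub_apply, inner_sub_right, map_sub, sum_apply, inner_sum, map_sum, one_apply_eq_self,
    inner_self_eq_norm_sq, sub_nonneg] at h1
  exact h1

/-- Grouping words by multi-length bounds each group by `⟪x, P_q x⟫`. This makes the Berezin kernel
a contraction. -/
theorem sum_norm_defect_sq_le (hR : IsGradedShift R V) (s : Finset (MultiWord n)) (x : E) :
    ∑ β ∈ s, ‖defect R (star (multiWordOp R β) x)‖ ^ 2 ≤ ‖x‖ ^ 2 := by
  classical
  have := hR.finite
  refine le_trans ?_ (hR.sum_re_inner_starProjection_le (s.image fun β i => (β i).length) x)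
  rw [← Finset.sum_fiberwise_of_maps_to (t := s.image fun β i => (β i).length)
    (g := fun β i => (β i).length) fun β hβ => Finset.mem_image_of_mem _ hβ]
  refine Finset.sum_le_sum fun q _ => ?_
  have h : RCLike.re ⟪x, (V q).starProjection x⟫_ℂ =
      ∑ β ∈ multiWordsOfLength n q, ‖defect R (star (multiWordOp R β) x)‖ ^ 2 := by
    rw [← hR.sum_inner_defect q, map_sum]
    exact Finset.sum_congr rfl fun β _ => inner_self_eq_norm_sq _
  rw [h]
  refine Finset.sum_le_sum_of_subset_of_nonneg (fun β hβ => ?_) fun _ _ _ => by positivity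
  rw [mem_multiWordsOfLength]
  exact fun i => congrFun (Finset.mem_filter.1 hβ).2 i

theorem exists_isBerezinKernel (hR : IsGradedShift R V) :
    ∃ K : E →L[ℂ] FockTensor n (defectSpace R), IsBerezinKernel R K ∧
      ∀ h β, (K h β : E) = defect R (star (multiWordOp R β) h) := by
  let D (β : MultiWord n) : E →ₗ[ℂ] defectSpace R :=
    ((defect R * star (multiWordOp R β) : E →L[ℂ] E) : E →ₗ[ℂ] E).codRestrict _ fun h =>
      Submodule.le_topologicalClosure _ ⟨_, rfl⟩
  have hD : ∀ β h, (D β h : E) = defect R (star (multiWordOp R β) h) := fun _ _ => rfl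
  have hsum : ∀ h (s : Finset (MultiWord n)), ∑ β ∈ s, ‖D β h‖ ^ (2 : ENNReal).toReal ≤
      ‖h‖ ^ (2 : ENNReal).toReal := by
    intro h s
    simp only [ENNReal.toReal_ofNat, Real.rpow_ofNat]
    exact hR.sum_norm_defect_sq_le s h
  let K₀ : E →ₗ[ℂ] FockTensor n (defectSpace R) :=
    { toFun h := ⟨fun β => D β h, memℓp_gen' (hsum h)⟩
      map_add' x y := lp.ext (funext fun β => map_add (D β) x y)
      map_smul' c x := lp.ext (funext fun β => map_smul (D β) c x) }
  have hK₀ : ∀ h, ‖K₀ h‖ ≤ 1 * ‖h‖ := by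
    intro h
    rw [one_mul]
    exact lp.norm_le_of_forall_sum_le (by simp) (norm_nonneg _) (hsum h)
  refine ⟨K₀.mkContinuous 1 hK₀, fun h β => ?_, fun h β => hD β h⟩
  rw [hR.sqrt_defect, ← star_multiWordOp hR.commute]
  exact hD β h

/-- Compressing to level `q` keeps the words of length `q`, and their contribution is the projection
computed in `sum_conj_defect`. -/
theorem adjoint_kernel_comp (hR : IsGradedShift R V)
    {K : E →L[ℂ] FockTensor n (defectSpace R)}
    (hK : ∀ h β, (K h β : E) = defect R (star (multiWordOp R β) h)) (q : Fin k → ℕ)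
    [FiniteDimensional ℂ (V q)] :
    ContinuousLinearMap.adjoint K ∘L fockProj n (defectSpace R) q ∘L K =
      (V q).starProjection := by
  ext h
  refine ext_inner_left ℂ fun y => ?_
  rw [ContinuousLinearMap.comp_apply, ContinuousLinearMap.adjoint_inner_right,
    ContinuousLinearMap.comp_apply, lp.inner_eq_tsum, ← hR.sum_inner_defect q]
  rw [tsum_eq_sum (s := multiWordsOfLength n q)]
  · refine Finset.sum_congr rfl fun β hβ => ?_
    rw [fockProj_apply, if_pos hβ, Submodule.coe_inner, hK, hK]
  · intro β hβ
    rw [fockProj_apply, if_neg hβ, inner_zero_right]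

theorem curvRatio_eq (hR : IsGradedShift R V) {K : E →L[ℂ] FockTensor n (defectSpace R)}
    (hK : ∀ h β, (K h β : E) = defect R (star (multiWordOp R β) h)) (q : Fin k → ℕ) :
    curvRatio R K q = dimRatio n V q := by
  have := hR.finite q
  rw [curvRatio, dimRatio, hR.adjoint_kernel_comp hK, opTrace_fockProj, opTrace_starProjection]
  simp

theorem hasCurvature (hR : IsGradedShift R V) {x C : ℝ}
    (hx : Tendsto (dimRatio n V) atTop (𝓝 x)) (hC : ∀ q, |dimRatio n V q - x| ≤ C) :
    HasCurvature R x := by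
  have := hR.finite 0
  obtain ⟨K, hK, hK'⟩ := hR.exists_isBerezinKernel
  refine ⟨?_, K, hK, ?_⟩
  · rw [hR.defect_eq, opTrace_starProjection]
    exact ENNReal.natCast_ne_top _
  · simp only [hR.curvRatio_eq hK']
    exact tendsto_simplex_average hx hC

theorem wordOp_mem (hR : IsGradedShift R V) (i : Fin k) (w : List (Fin (n i))) (q : Fin k → ℕ)
    {x : E} (hx : x ∈ V q) : wordOp R i w x ∈ V (q + Pi.single i w.length) := by
  induction w with
  | nil => simpa [wordOp] using hx
  | cons a w ih =>
    have := hR.map_mem _ i a _ ih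
    rwa [add_assoc, ← Pi.single_add] at this

theorem multiWordOp_mem (hR : IsGradedShift R V) (α : MultiWord n) (q : Fin k → ℕ)
    {x : E} (hx : x ∈ V q) : multiWordOp R α x ∈ V (q + fun i => (α i).length) := by
  have key : ∀ l : List (Fin k), (l.map fun i => wordOp R i (α i)).prod x ∈
      V (q + (l.map fun i => (Pi.single i (α i).length : Fin k → ℕ)).sum) := by
    intro l
    induction l with
    | nil => simpa using hx
    | cons i l ih =>
      have := hR.wordOp_mem i (α i) _ ih
      rwa [add_assoc, add_comm (List.sum _)] at this
  have h := key (List.finRange k)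
  rw [← List.ofFn_eq_map, ← List.ofFn_eq_map, List.sum_ofFn, Finset.univ_sum_single] at h
  exact h

/-- A vector `x ∈ V s` equals `∑_β R_β Δ R_β^* x` over words of length `s`. -/
theorem le_eulerSpace (hR : IsGradedShift R V) {s q : Fin k → ℕ} (hs : s ≤ q) :
    V s ≤ eulerSpace R q := by
  have := hR.finite s
  intro x hx
  rw [← Submodule.starProjection_eq_self_iff.2 hx, ← hR.sum_conj_defect s, sum_apply]
  refine Submodule.sum_mem _ fun β hβ => Submodule.subset_span ⟨β, fun i => ?_, _, ⟨_, rfl⟩, rfl⟩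
  rw [mem_multiWordsOfLength.1 hβ i]
  exact hs i

/-- The Euler space is the internal direct sum of the `V s`, `s ≤ q`: words of length `s` send `V 0`
into `V s`, and orthogonality makes the sum direct. -/
theorem finrank_eulerSpace (hR : IsGradedShift R V) (q : Fin k → ℕ) :
    Module.finrank ℂ (eulerSpace R q) = ∑ s ∈ Finset.Iic q, Module.finrank ℂ (V s) := by
  classical
  have := hR.finite
  let f : ((s : Finset.Iic q) → V s) →ₗ[ℂ] E :=
    ∑ s : Finset.Iic q, (V s).subtype ∘ₗ LinearMap.proj s
  have hf : ∀ v, f v = ∑ s : Finset.Iic q, (v s : E) := fun v => by simp [f]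
  have hinj : Function.Injective f := by
    rw [← LinearMap.ker_eq_bot, LinearMap.ker_eq_bot']
    intro v hv
    ext s
    rw [hf] at hv
    have h1 := congrArg (V s).starProjection hv
    rw [map_sum, map_zero, Finset.sum_eq_single s] at h1
    · rwa [Submodule.starProjection_eq_self_iff.2 (v s).2] at h1
    · intro r _ hrs
      rw [hR.isDiagonal_starProjection s r _ (v r).2]
      exact (congrArg (· • (v r : E)) (if_neg fun h => hrs (Subtype.ext h))).trans (zero_smul _ _)
    · simp
  have hrange : f.range = eulerSpace R q := by
    apply le_antisymm
    · rintro _ ⟨v, rfl⟩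
      rw [hf]
      exact Submodule.sum_mem _ fun s _ => hR.le_eulerSpace (Finset.mem_Iic.1 s.2) (v s).2
    · refine Submodule.span_le.2 ?_
      rintro _ ⟨α, hα, h, hh, rfl⟩
      rw [hR.range_defect] at hh
      have hmem := hR.multiWordOp_mem α 0 hh
      rw [zero_add] at hmem
      refine ⟨Pi.single ⟨fun i => (α i).length, Finset.mem_Iic.2 hα⟩ ⟨_, hmem⟩, ?_⟩
      rw [hf, Finset.sum_eq_single ⟨fun i => (α i).length, Finset.mem_Iic.2 hα⟩]
      · simp
      · intro r _ hr
        rw [Pi.single_eq_of_ne hr]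
        rfl
      · simp
  rw [← hrange, LinearMap.finrank_range_of_inj hinj, Module.finrank_pi_fintype]
  exact Finset.sum_coe_sort (Finset.Iic q) fun s => Module.finrank ℂ (V s)

theorem eulerRatio_eq (hR : IsGradedShift R V) (hn : ∀ i, 1 ≤ n i) (q : Fin k → ℕ) :
    eulerRatio R q = (∑ s ∈ Finset.Iic q, (∏ i, (n i : ℝ) ^ s i) * dimRatio n V s) /
      ∏ i, ∑ r ∈ Finset.range (q i + 1), (n i : ℝ) ^ r := by
  rw [eulerRatio, hR.finrank_eulerSpace, Nat.cast_sum]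
  congr 1
  refine Finset.sum_congr rfl fun s _ => ?_
  have hpos : (0 : ℝ) < ∏ i, (n i : ℝ) ^ s i :=
    Finset.prod_pos fun i _ => pow_pos (by exact_mod_cast hn i) _
  rw [dimRatio, mul_div_cancel₀ _ hpos.ne']

theorem hasEulerChar (hR : IsGradedShift R V) (hn : ∀ i, 1 ≤ n i) {x C : ℝ}
    (hx : Tendsto (dimRatio n V) atTop (𝓝 x)) (hC : ∀ q, |dimRatio n V q - x| ≤ C) :
    HasEulerChar R x := by
  refine ⟨hR.hasFiniteRank, fun q hq hcof => ?_⟩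
  simp only [hR.eulerRatio_eq hn]
  exact tendsto_box_average hn hx hC (tendsto_atTop_atTop_of_monotone hq hcof)

end IsGradedShift

end Berezin

/-! ### Spectral subspaces of the gauge group -/

section Spectral

variable {H : Type*} [NormedAddCommGroup H] [InnerProductSpace ℂ H] [CompleteSpace H]
variable {k : ℕ} {n : Fin k → ℕ}

theorem GaugeGroup.inner_map_map (U : GaugeGroup k H) (z : Fin k → Circle) (x y : H) :
    ⟪(U.rep z : H →L[ℂ] H) x, (U.rep z : H →L[ℂ] H) y⟫_ℂ = ⟪x, y⟫_ℂ :=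
  ContinuousLinearMap.inner_map_map_of_mem_unitary (U.rep z).2 x y

theorem exists_circle_zpow_ne_one {m : ℤ} (hm : m ≠ 0) : ∃ z : Circle, z ^ m ≠ 1 := by
  -- The `m`-th power of this point is `-1`.
  refine ⟨Circle.exp (Real.pi / m), fun h => ?_⟩
  have h2 := congrArg (Subtype.val : Circle → ℂ) h
  rw [Circle.coe_zpow, Circle.coe_exp, ← Complex.exp_int_mul, Circle.coe_one] at h2
  have h3 : (m : ℂ) * (((Real.pi / m : ℝ) : ℂ) * Complex.I) = Real.pi * Complex.I := by
    have : (m : ℂ) ≠ 0 := by exact_mod_cast hm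
    push_cast
    field_simp
  rw [h3, Complex.exp_pi_mul_I] at h2
  norm_num at h2

theorem spectralSubspace_ortho (U : GaugeGroup k H) {s t : Fin k → ℤ} (hst : s ≠ t) {x y : H}
    (hx : x ∈ spectralSubspace U s) (hy : y ∈ spectralSubspace U t) : ⟪x, y⟫_ℂ = 0 := by
  obtain ⟨i, hi⟩ := Function.ne_iff.1 hst
  obtain ⟨w, hw⟩ := exists_circle_zpow_ne_one (sub_ne_zero.2 hi.symm)
  have key : ∀ r : Fin k → ℤ, ∏ j, ((Function.update 1 i w : Fin k → Circle) j : ℂ) ^ r j =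
      (w : ℂ) ^ r i := by
    intro r
    rw [Finset.prod_eq_single i]
    · simp
    · intro j _ hj
      simp [hj]
    · simp
  have h := U.inner_map_map (Function.update 1 i w) x y
  rw [hx, hy, key, key, inner_smul_left, inner_smul_right, ← mul_assoc] at h
  by_contra hne
  have h1 := mul_right_cancel₀ hne (h.trans (one_mul _).symm)
  apply hw
  ext
  rw [← Circle.coe_zpow, ← Circle.coe_inv_eq_conj, ← zpow_neg, Circle.coe_zpow,
    ← zpow_add₀ (Circle.coe_ne_zero w)] at h1
  rw [Circle.coe_zpow, sub_eq_add_neg, add_comm, h1, Circle.coe_one]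

theorem orthogonalFamily_spectralSubspace (U : GaugeGroup k H) :
    OrthogonalFamily ℂ (fun s => spectralSubspace U s) fun s => (spectralSubspace U s).subtypeₗᵢ :=
  fun _ _ hst x y => spectralSubspace_ortho U hst x.2 y.2

attribute [local instance] instMeasureSpaceUnitAddCircle

open MeasureTheory UnitAddTorus in
-- The Fourier coefficients of `t ↦ U(t) y` lie in the spectral subspaces, so `⟪y, U(t) y⟫` has zero
-- Fourier coefficients; being continuous it vanishes, in particular at `t = 0`, where it is `⟪y,
-- y⟫`.
theorem eq_zero_of_forall_spectralSubspace (U : GaugeGroup k H) {y : H}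
    (hy : ∀ s, ∀ x ∈ spectralSubspace U s, ⟪y, x⟫_ℂ = 0) : y = 0 := by
  have : Measure.IsAddHaarMeasure (volume : Measure UnitAddCircle) :=
    inferInstanceAs (Measure.IsAddHaarMeasure AddCircle.haarAddCircle)
  have : IsProbabilityMeasure (volume : Measure UnitAddCircle) :=
    inferInstanceAs (IsProbabilityMeasure AddCircle.haarAddCircle)
  let c : UnitAddTorus (Fin k) → Fin k → Circle := fun t i => AddCircle.toCircle (t i)
  have hc : Continuous c :=
    continuous_pi fun i => AddCircle.continuous_toCircle.comp (continuous_apply i)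
  have hcadd : ∀ t₀ t, c (t₀ + t) = c t₀ * c t :=
    fun t₀ t => funext fun i => AddCircle.toCircle_add _ _
  have hfour : ∀ (s : Fin k → ℤ) t, mFourier s t = ∏ i, (c t i : ℂ) ^ s i := by
    intro s t
    change ∏ i, fourier (s i) (t i) = _
    refine Finset.prod_congr rfl fun i _ => ?_
    rw [fourier_apply, AddCircle.toCircle_zsmul, Circle.coe_zpow]
  have hUc : Continuous fun t => (U.rep (c t) : H →L[ℂ] H) y := (U.continuous_apply y).comp hc
  have hint : ∀ s, Integrable (fun t => mFourier (-s) t • (U.rep (c t) : H →L[ℂ] H) y)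
      (volume : Measure (UnitAddTorus (Fin k))) := fun s =>
    ((map_continuous (mFourier (-s))).smul hUc).integrable_of_hasCompactSupport
      (HasCompactSupport.of_compactSpace _)
  have hmem : ∀ s, ∫ t, mFourier (-s) t • (U.rep (c t) : H →L[ℂ] H) y ∈ spectralSubspace U s := by
    intro s z
    obtain ⟨t₀, rfl⟩ : ∃ t₀, c t₀ = z :=
      ⟨fun i => (AddCircle.homeomorphCircle one_ne_zero).symm (z i), funext fun i =>
        (AddCircle.homeomorphCircle_apply one_ne_zero _).symm.trans
          ((AddCircle.homeomorphCircle one_ne_zero).apply_symm_apply (z i))⟩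
    rw [← ContinuousLinearMap.integral_comp_comm _ (hint s), ← hfour, ← integral_smul]
    -- Invariance of Haar measure turns the action of `U` into multiplication by a character.
    conv_rhs => rw [← integral_add_left_eq_self _ t₀]
    refine integral_congr_ae (Filter.Eventually.of_forall fun t => ?_)
    have hne : mFourier s t₀ ≠ 0 := by
      rw [hfour]
      exact Finset.prod_ne_zero_iff.2 fun i _ => zpow_ne_zero _ (Circle.coe_ne_zero _)
    have hchar : mFourier s t₀ * mFourier (-s) (t₀ + t) = mFourier (-s) t := by
      simp only [hfour, hcadd, Pi.mul_apply, Circle.coe_mul, mul_zpow, Finset.prod_mul_distrib,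
        Pi.neg_apply]
      rw [← mul_assoc, ← Finset.prod_mul_distrib, Finset.prod_eq_one, one_mul]
      intro i _
      rw [← zpow_add₀ (Circle.coe_ne_zero _), add_neg_cancel, zpow_zero]
    simp only
    rw [smul_smul, hchar, map_smul, hcadd, map_mul]
    rfl
  let f : C(UnitAddTorus (Fin k), ℂ) :=
    ⟨fun t => ⟪y, (U.rep (c t) : H →L[ℂ] H) y⟫_ℂ, continuous_const.inner hUc⟩
  have hcoef : mFourierCoeff f = 0 := by
    ext s
    have h1 : mFourierCoeff f s =
        ∫ t, ⟪y, mFourier (-s) t • (U.rep (c t) : H →L[ℂ] H) y⟫_ℂ := by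
      refine integral_congr_ae (Filter.Eventually.of_forall fun t => ?_)
      simp only
      rw [inner_smul_right]
      rfl
    rw [h1, integral_inner (hint s)]
    exact hy s _ (hmem s)
  -- The coefficients are trivially summable, so the Fourier series converges to `f` pointwise.
  have hsum := hasSum_mFourier_series_apply_of_summable (f := f)
    (by rw [hcoef]; exact summable_zero) 0
  simp only [hcoef, Pi.zero_apply, zero_smul] at hsum
  have h0 : f 0 = 0 := hsum.unique hasSum_zero
  have hc0 : c 0 = 1 := funext fun i => AddCircle.toCircle_zero
  have h1 : f 0 = ⟪y, y⟫_ℂ := by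
    change ⟪y, (U.rep (c 0) : H →L[ℂ] H) y⟫_ℂ = _
    rw [hc0, map_one]
    rfl
  rw [h1] at h0
  exact inner_self_eq_zero.1 h0

end Spectral

/-! ### Partial defects and the use of purity -/

section Positivity

variable {H : Type*} [NormedAddCommGroup H] [InnerProductSpace ℂ H] [CompleteSpace H]
variable {k : ℕ} {n : Fin k → ℕ} {T : OpTuple n H}

theorem cpMap_apply_apply (T : OpTuple n H) (i : Fin k) (Y : H →L[ℂ] H) (x : H) :
    cpMap T i Y x = ∑ j, T i j (Y (star (T i j) x)) := by
  change (∑ j, T i j * Y * star (T i j)) x = _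
  rw [sum_apply]
  rfl

theorem cpMap_mono (T : OpTuple n H) (i : Fin k) : Monotone (cpMap T i) := fun _ _ h =>
  Finset.sum_le_sum fun j _ => star_right_conjugate_le_conjugate h (T i j)

theorem cpMap_pow_mono (T : OpTuple n H) (i : Fin k) (p : ℕ) : Monotone ((cpMap T i) ^ p) := by
  rw [Module.End.coe_pow]
  exact (cpMap_mono T i).iterate p

theorem commute_cpMap
    (hT : ∀ s t : Fin k, s ≠ t → ∀ (i : Fin (n s)) (j : Fin (n t)), Commute (T s i) (T t j))
    (i j : Fin k) : Commute (cpMap T i) (cpMap T j) := by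
  by_cases hij : i = j
  · rw [hij]
  · refine LinearMap.ext fun Y => ?_
    change ∑ a, T i a * (∑ b, T j b * Y * star (T j b)) * star (T i a) =
      ∑ b, T j b * (∑ a, T i a * Y * star (T i a)) * star (T j b)
    simp only [Finset.mul_sum, Finset.sum_mul]
    rw [Finset.sum_comm]
    refine Finset.sum_congr rfl fun b _ => Finset.sum_congr rfl fun a _ => ?_
    have h := (hT i j hij a b).eq
    calc T i a * (T j b * Y * star (T j b)) * star (T i a)
        = (T i a * T j b) * Y * star (T i a * T j b) := by simp only [star_mul, mul_assoc]
      _ = T j b * (T i a * Y * star (T i a)) * star (T j b) := by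
          rw [h]
          simp only [star_mul, mul_assoc]

/-- The operator `∏_{i ∈ l} (id - Φ_{T_i}) (I)`. -/
noncomputable def listDefect (T : OpTuple n H) (l : List (Fin k)) : H →L[ℂ] H :=
  (l.map fun i => 1 - cpMap T i).prod 1

theorem listDefect_cons (T : OpTuple n H) (i : Fin k) (l : List (Fin k)) :
    listDefect T (i :: l) = listDefect T l - cpMap T i (listDefect T l) := by
  rw [listDefect, List.map_cons, List.prod_cons, Module.End.mul_apply]
  rfl

theorem listDefect_nil (T : OpTuple n H) : listDefect T [] = 1 := by
  simp [listDefect]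

theorem listDefect_perm (hT : MemPolyball T) {l l' : List (Fin k)} (h : l.Perm l') :
    listDefect T l = listDefect T l' := by
  rw [listDefect, listDefect, (h.map fun i => 1 - cpMap T i).prod_eq']
  rw [List.pairwise_map]
  refine List.pairwise_of_forall fun i j => ?_
  exact (Commute.one_right _).sub_right
    ((Commute.one_left _).sub_left (commute_cpMap hT.commute i j))

theorem defect_eq_listDefect (T : OpTuple n H) : defect T = listDefect T (List.finRange k) := by
  simp [defect, defectMap, listDefect, List.ofFn_eq_map]

theorem listDefect_nonneg (hT : MemPolyball T) {l : List (Fin k)} (hl : l.Nodup) :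
    0 ≤ listDefect T l := by
  have h := hT.isPositive (fun i => if i ∈ l then 1 else 0) fun i => by split_ifs <;> simp
  rw [ContinuousLinearMap.nonneg_iff_isPositive]
  have key : ∀ L : List (Fin k), (L.map fun i => (1 - cpMap T i) ^ (if i ∈ l then 1 else 0)).prod =
      ((L.filter (· ∈ l)).map fun i => 1 - cpMap T i).prod := by
    intro L
    induction L with
    | nil => simp
    | cons i L ih =>
      rw [List.map_cons, List.prod_cons, ih]
      by_cases hi : i ∈ l <;> simp [hi]
  rw [defectMap, List.ofFn_eq_map, key] at h
  change (listDefect T ((List.finRange k).filter (· ∈ l))).IsPositive at h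
  rwa [listDefect_perm hT] at h
  rw [List.perm_ext_iff_of_nodup ((List.nodup_finRange k).filter _) hl]
  simp

theorem listDefect_le_one (hT : MemPolyball T) {l : List (Fin k)} (hl : l.Nodup) :
    listDefect T l ≤ 1 := by
  induction l with
  | nil => rw [listDefect_nil]
  | cons i l ih =>
    rw [List.nodup_cons] at hl
    have h := cpMap_mono T i (listDefect_nonneg hT hl.2)
    rw [map_zero] at h
    rw [listDefect_cons]
    exact (sub_le_self _ h).trans (ih hl.2)

theorem apply_eq_zero_of_nonneg {A : H →L[ℂ] H} (hA : 0 ≤ A) {x : H}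
    (h : RCLike.re ⟪A x, x⟫_ℂ ≤ 0) : A x = 0 := by
  have hs : CFC.sqrt A * CFC.sqrt A = A := CFC.sqrt_mul_sqrt_self A hA
  have hsa : star (CFC.sqrt A) = CFC.sqrt A := (CFC.sqrt_nonneg A).isSelfAdjoint
  have h1 : ⟪A x, x⟫_ℂ = ⟪CFC.sqrt A x, CFC.sqrt A x⟫_ℂ := by
    conv_rhs => rw [← ContinuousLinearMap.adjoint_inner_left, ← ContinuousLinearMap.star_eq_adjoint,
      hsa, ← mul_apply_eq_comp, hs]
  rw [h1, inner_self_eq_norm_sq] at h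
  have h2 : CFC.sqrt A x = 0 := by
    rw [← norm_eq_zero]
    exact pow_eq_zero_iff two_ne_zero |>.1 (le_antisymm h (sq_nonneg _))
  rw [← hs, mul_apply_eq_comp, h2, map_zero]

/-- The hypotheses telescope to `A x = Φ^q(A) x`, so `⟪A x, x⟫ ≤ ⟪Φ^q(1) x, x⟫`, which tends to `0`.
-/
theorem apply_eq_zero_of_forall_pow (hpure : IsPure T) {A : H →L[ℂ] H} (hA : 0 ≤ A) (hA1 : A ≤ 1)
    (i : Fin k) {x : H} (h : ∀ q : ℕ, ((cpMap T i) ^ q) (A - cpMap T i A) x = 0) : A x = 0 := by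
  have hstep : ∀ q : ℕ, ((cpMap T i) ^ q) A x = A x := by
    intro q
    induction q with
    | zero => rfl
    | succ q ih =>
      have := h q
      rw [map_sub, sub_apply, sub_eq_zero, ← Module.End.mul_apply, ← pow_succ] at this
      rw [← this, ih]
  refine apply_eq_zero_of_nonneg hA ?_
  have hlim : Tendsto (fun p : ℕ => RCLike.re ⟪((cpMap T i) ^ p) 1 x, x⟫_ℂ) atTop (𝓝 0) := by
    have := (hpure i x).inner (𝕜 := ℂ) (tendsto_const_nhds (x := x))
    rw [inner_zero_left] at this
    have hre := (RCLike.continuous_re.tendsto _).comp this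
    rw [map_zero] at hre
    exact hre
  refine ge_of_tendsto' hlim fun p => ?_
  have h1 := cpMap_pow_mono T i p hA1
  rw [ContinuousLinearMap.le_def] at h1
  have h2 := h1.re_inner_nonneg_left x
  rw [sub_apply, inner_sub_left, map_sub, hstep] at h2
  linarith

end Positivity

/-! ### Degree bounds for a graded pure tuple -/

section Graded

variable {H : Type*} [NormedAddCommGroup H] [InnerProductSpace ℂ H] [CompleteSpace H]
variable {k : ℕ} {n : Fin k → ℕ} {T : OpTuple n H} {U : GaugeGroup k H}

theorem prod_zpow_add_single (z : Fin k → Circle) (s : Fin k → ℤ) (i : Fin k) (m : ℤ) :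
    ∏ j, (z j : ℂ) ^ (s + Pi.single i m : Fin k → ℤ) j =
      (z i : ℂ) ^ m * ∏ j, (z j : ℂ) ^ s j := by
  have h : ∀ j, (z j : ℂ) ^ (s + Pi.single i m : Fin k → ℤ) j =
      (z j : ℂ) ^ (Pi.single i m : Fin k → ℤ) j * (z j : ℂ) ^ s j := fun j => by
    rw [Pi.add_apply, add_comm, zpow_add₀ (Circle.coe_ne_zero _)]
  rw [Finset.prod_congr rfl fun j _ => h j, Finset.prod_mul_distrib]
  congr 1
  rw [Finset.prod_eq_single i] <;> simp +contextual

namespace IsGraded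

theorem rep_mul (hU : IsGraded T U) (z : Fin k → Circle) (i : Fin k) (j : Fin (n i)) :
    (U.rep z : H →L[ℂ] H) * T i j = (z i : ℂ) • (T i j * (U.rep z : H →L[ℂ] H)) := by
  have h := congrArg (· * (U.rep z : H →L[ℂ] H)) (hU z i j)
  simp only [mul_assoc, smul_mul_assoc] at h
  rwa [Unitary.coe_star_mul_self, mul_one] at h

theorem rep_mul_star (hU : IsGraded T U) (z : Fin k → Circle) (i : Fin k) (j : Fin (n i)) :
    (U.rep z : H →L[ℂ] H) * star (T i j) =
      ((z i)⁻¹ : ℂ) • (star (T i j) * (U.rep z : H →L[ℂ] H)) := by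
  have h := congrArg (fun A => star A * (U.rep z : H →L[ℂ] H)) (hU z i j)
  simp only [star_mul, star_star, mul_assoc, star_smul, smul_mul_assoc] at h
  rw [Unitary.coe_star_mul_self, mul_one] at h
  rw [h, ← Circle.coe_inv, Circle.coe_inv_eq_conj]
  rfl

theorem map_mem (hU : IsGraded T U) {s : Fin k → ℤ} (i : Fin k) (j : Fin (n i)) {x : H}
    (hx : x ∈ spectralSubspace U s) : T i j x ∈ spectralSubspace U (s + Pi.single i 1) := by
  intro z
  have h := congrArg (fun A : H →L[ℂ] H => A x) (hU.rep_mul z i j)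
  simp only [mul_apply_eq_comp, smul_apply] at h
  rw [h, hx z, prod_zpow_add_single, map_smul, smul_smul, zpow_one]

theorem adj_mem (hU : IsGraded T U) {s : Fin k → ℤ} (i : Fin k) (j : Fin (n i)) {x : H}
    (hx : x ∈ spectralSubspace U s) :
    star (T i j) x ∈ spectralSubspace U (s - Pi.single i 1) := by
  intro z
  have h := congrArg (fun A : H →L[ℂ] H => A x) (hU.rep_mul_star z i j)
  simp only [mul_apply_eq_comp, smul_apply] at h
  rw [h, hx z, sub_eq_add_neg, ← Pi.single_neg, prod_zpow_add_single, map_smul, smul_smul,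
    zpow_neg_one]

theorem cpMap_mem (hU : IsGraded T U) {Y : H →L[ℂ] H}
    (hY : ∀ s, ∀ x ∈ spectralSubspace U s, Y x ∈ spectralSubspace U s) (i : Fin k)
    (s : Fin k → ℤ) (x : H) (hx : x ∈ spectralSubspace U s) :
    cpMap T i Y x ∈ spectralSubspace U s := by
  rw [cpMap_apply_apply]
  refine Submodule.sum_mem _ fun j _ => ?_
  have := hU.map_mem i j (hY _ _ (hU.adj_mem i j hx))
  rwa [sub_add_cancel] at this

theorem listDefect_mem (hU : IsGraded T U) (l : List (Fin k)) (s : Fin k → ℤ) (x : H)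
    (hx : x ∈ spectralSubspace U s) : listDefect T l x ∈ spectralSubspace U s := by
  induction l generalizing s x with
  | nil => rwa [listDefect_nil]
  | cons i l ih =>
    rw [listDefect_cons, sub_apply]
    exact Submodule.sub_mem _ (ih s x hx) (hU.cpMap_mem ih i s x hx)

/-- On degree `s`, `Φ_{T_i}^q(Y)` only applies `Y` to vectors lowered `q` times in coordinate `i`.
-/
theorem cpMap_pow_apply_eq_zero (hU : IsGraded T U) (i : Fin k) {Y : H →L[ℂ] H} (q : ℕ)
    {s : Fin k → ℤ} (hY : ∀ x ∈ spectralSubspace U (s - Pi.single i (q : ℤ)), Y x = 0) {x : H}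
    (hx : x ∈ spectralSubspace U s) : ((cpMap T i) ^ q) Y x = 0 := by
  induction q generalizing s x with
  | zero => exact hY x (by simpa using hx)
  | succ q ih =>
    rw [pow_succ', Module.End.mul_apply, cpMap_apply_apply]
    refine Finset.sum_eq_zero fun j _ => ?_
    rw [ih (s := s - Pi.single i 1) ?_ (hU.adj_mem i j hx), map_zero]
    intro y hy
    refine hY y ?_
    rwa [sub_sub, ← Pi.single_add, add_comm (1 : ℤ), ← Nat.cast_succ] at hy

/-- The defect preserves degrees, so each degree in its support gives a nonzero subspace of its
range; these are mutually orthogonal. -/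
theorem finite_support_defect (hU : IsGraded T U) (hrank : HasFiniteRank T) :
    {s | ∃ x ∈ spectralSubspace U s, defect T x ≠ 0}.Finite := by
  have : FiniteDimensional ℂ (defect T).range := hrank
  let N (s : Fin k → ℤ) : Submodule ℂ (defect T).range :=
    (spectralSubspace U s).comap (defect T).range.subtype
  have hN : OrthogonalFamily ℂ (fun s => N s) fun s => (N s).subtypeₗᵢ :=
    fun s t hst x y => spectralSubspace_ortho U hst x.2 y.2
  refine (Submodule.finite_ne_bot_of_iSupIndep hN.independent).subset ?_
  rintro s ⟨x, hx, hne⟩ hbot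
  have hmem : (⟨defect T x, ⟨x, rfl⟩⟩ : (defect T).range) ∈ N s := by
    change defect T x ∈ spectralSubspace U s
    rw [defect_eq_listDefect]
    exact hU.listDefect_mem _ s x hx
  rw [hbot, Submodule.mem_bot] at hmem
  exact hne (congrArg Subtype.val hmem)

theorem exists_bounds (hU : IsGraded T U) (hrank : HasFiniteRank T) :
    ∃ c d : Fin k → ℤ, c ≤ d ∧
      ∀ s, ∀ x ∈ spectralSubspace U s, defect T x ≠ 0 → c ≤ s ∧ s ≤ d := by
  have hfin := hU.finite_support_defect hrank
  obtain ⟨c, hc⟩ := hfin.bddBelow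
  obtain ⟨d, hd⟩ := hfin.bddAbove
  -- The supremum secures `c ≤ d` even when the support is empty.
  exact ⟨c, c ⊔ d, le_sup_left, fun s x hx hne =>
    ⟨hc ⟨x, hx, hne⟩, (hd ⟨x, hx, hne⟩).trans le_sup_right⟩⟩

theorem exists_ne_zero_of_listDefect (hT : MemPolyball T) (hpure : IsPure T) (hU : IsGraded T U)
    {i : Fin k} {l : List (Fin k)} (hl : (i :: l).Nodup) {s : Fin k → ℤ} {x : H}
    (hx : x ∈ spectralSubspace U s) (hne : listDefect T l x ≠ 0) :
    ∃ q : ℕ, ∃ y ∈ spectralSubspace U (s - Pi.single i (q : ℤ)), listDefect T (i :: l) y ≠ 0 := by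
  by_contra! h
  have hl' := (List.nodup_cons.1 hl).2
  refine hne (apply_eq_zero_of_forall_pow hpure (listDefect_nonneg hT hl')
    (listDefect_le_one hT hl') i fun q => ?_)
  rw [← listDefect_cons]
  exact hU.cpMap_pow_apply_eq_zero i q (h q) hx

/-- Adjoining the indices of `l'` to `l` one at a time lowers only the corresponding coordinates and
ends at the full defect. The lower bound thus passes up to `s`, and the upper bound survives in the
untouched coordinates, those in `l`. -/
theorem listDefect_bounds (hT : MemPolyball T) (hpure : IsPure T) (hU : IsGraded T U)
    {c d : Fin k → ℤ}
    (hcd : ∀ s, ∀ x ∈ spectralSubspace U s, defect T x ≠ 0 → c ≤ s ∧ s ≤ d)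
    (l' l : List (Fin k)) (hl : (l' ++ l).Perm (List.finRange k)) {s : Fin k → ℤ} {x : H}
    (hx : x ∈ spectralSubspace U s) (hne : listDefect T l x ≠ 0) :
    c ≤ s ∧ ∀ i ∈ l, s i ≤ d i := by
  induction l' generalizing l s x with
  | nil =>
    rw [List.nil_append] at hl
    rw [listDefect_perm hT hl, ← defect_eq_listDefect] at hne
    exact (hcd s x hx hne).imp_right fun h i _ => h i
  | cons i l' ih =>
    have hperm : (l' ++ i :: l).Perm (List.finRange k) := List.perm_middle.trans hl
    have hnd : (i :: l).Nodup :=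
      (hperm.nodup_iff.2 (List.nodup_finRange k)).of_append_right
    obtain ⟨q, y, hy, hyne⟩ := exists_ne_zero_of_listDefect hT hpure hU hnd hx hne
    obtain ⟨h1, h2⟩ := ih (i :: l) hperm hy hyne
    constructor
    · refine h1.trans (sub_le_self _ ?_)
      simp
    · intro j hj
      have hji : j ≠ i := fun h => (List.nodup_cons.1 hnd).1 (h ▸ hj)
      simpa [hji] using h2 j (List.mem_cons_of_mem _ hj)

theorem le_of_mem_spectralSubspace (hT : MemPolyball T) (hpure : IsPure T) (hU : IsGraded T U)
    {c d : Fin k → ℤ}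
    (hcd : ∀ s, ∀ x ∈ spectralSubspace U s, defect T x ≠ 0 → c ≤ s ∧ s ≤ d)
    {s : Fin k → ℤ} {x : H} (hx : x ∈ spectralSubspace U s) (hne : x ≠ 0) : c ≤ s :=
  (listDefect_bounds hT hpure hU hcd (List.finRange k) [] (by simp) hx
    (by rwa [listDefect_nil])).1

theorem sum_apply_star_eq_self (hT : MemPolyball T) (hpure : IsPure T) (hU : IsGraded T U)
    {c d : Fin k → ℤ}
    (hcd : ∀ s, ∀ x ∈ spectralSubspace U s, defect T x ≠ 0 → c ≤ s ∧ s ≤ d)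
    {s : Fin k → ℤ} {i : Fin k} (hs : d i < s i) {x : H} (hx : x ∈ spectralSubspace U s) :
    ∑ j, T i j (star (T i j) x) = x := by
  have h0 : listDefect T [i] x = 0 := by
    by_contra hne
    have hperm : ((List.finRange k).erase i ++ [i]).Perm (List.finRange k) :=
      (List.perm_append_singleton _ _).trans (List.perm_cons_erase (List.mem_finRange i)).symm
    exact hs.not_ge
      ((listDefect_bounds hT hpure hU hcd _ [i] hperm hx hne).2 i (List.mem_singleton_self i))
  rw [listDefect_cons, listDefect_nil, sub_apply, sub_eq_zero, cpMap_apply_apply] at h0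
  exact h0.symm

/-- A vector killed by the defect and all `T_{i,j}^*` is zero, so `H_s` embeds in finitely many
copies of the `H_{s - e_i}` times the range of the defect. The induction is on `∑ (s i - c i)`,
negative values forcing `H_s = 0`. -/
theorem finiteDimensional_spectralSubspace (hT : MemPolyball T) (hpure : IsPure T)
    (hrank : HasFiniteRank T) (hU : IsGraded T U) (s : Fin k → ℤ) :
    FiniteDimensional ℂ (spectralSubspace U s) := by
  obtain ⟨c, d, -, hcd⟩ := hU.exists_bounds hrank
  have : FiniteDimensional ℂ (defect T).range := hrank
  have hbot : ∀ s, ¬ c ≤ s → FiniteDimensional ℂ (spectralSubspace U s) := by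
    intro s hs
    have : spectralSubspace U s = ⊥ := (Submodule.eq_bot_iff _).2 fun x hx => by
      by_contra hne
      exact hs (le_of_mem_spectralSubspace hT hpure hU hcd hx hne)
    rw [this]
    infer_instance
  have key : ∀ (N : ℕ) (s : Fin k → ℤ), ∑ i, (s i - c i) < N →
      FiniteDimensional ℂ (spectralSubspace U s) := by
    intro N
    induction N with
    | zero =>
      intro s hs
      refine hbot s fun hcs => hs.not_ge ?_
      exact_mod_cast Finset.sum_nonneg fun i _ => sub_nonneg.2 (hcs i)
    | succ N ih =>
      intro s hs
      have hfd : ∀ i, FiniteDimensional ℂ (spectralSubspace U (s - Pi.single i 1)) := by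
        intro i
        refine ih _ ?_
        have : ∑ j, ((s - Pi.single i 1 : Fin k → ℤ) j - c j) = ∑ j, (s j - c j) - 1 := by
          simp only [Pi.sub_apply, Finset.sum_sub_distrib, Finset.sum_pi_single', Finset.mem_univ,
            if_true]
          ring
        rw [this]
        push_cast at hs
        linarith
      let f : spectralSubspace U s →ₗ[ℂ]
          ((i : Fin k) → Fin (n i) → spectralSubspace U (s - Pi.single i 1)) ×
            (defect T).range :=
        LinearMap.prod
          (LinearMap.pi fun i => LinearMap.pi fun j =>
            (((star (T i j) : H →L[ℂ] H) : H →ₗ[ℂ] H).domRestrict _).codRestrict _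
              fun x => hU.adj_mem i j x.2)
          ((defect T : H →ₗ[ℂ] H).rangeRestrict.domRestrict _)
      refine FiniteDimensional.of_injective f ?_
      rw [← LinearMap.ker_eq_bot, LinearMap.ker_eq_bot']
      intro x hx
      have h1 : ∀ i j, star (T i j) (x : H) = 0 := fun i j =>
        congrArg Subtype.val (congrFun (congrFun (congrArg Prod.fst hx) i) j)
      have h2 : defect T (x : H) = 0 := congrArg Subtype.val (congrArg Prod.snd hx)
      -- Where all `T_{i,j}^*` vanish, every partial defect acts as the identity.
      have h3 : ∀ l : List (Fin k), listDefect T l (x : H) = x := by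
        intro l
        induction l with
        | nil => rw [listDefect_nil]; rfl
        | cons i l ihl =>
          rw [listDefect_cons, sub_apply, cpMap_apply_apply, ihl]
          simp [h1]
      rw [defect_eq_listDefect, h3] at h2
      exact Subtype.ext h2
  exact key (∑ i, (s i - c i) + 1).toNat s (by
    have := Int.self_le_toNat (∑ i, (s i - c i) + 1)
    linarith)

end IsGraded

end Graded

/-! ### Restriction to the degrees above `d` -/

section Restriction

variable {H : Type*} [NormedAddCommGroup H] [InnerProductSpace ℂ H] [CompleteSpace H]
variable {k : ℕ} {n : Fin k → ℕ} {T : OpTuple n H} {U : GaugeGroup k H}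

namespace IsGraded

theorem isInvariant_spectralSum (hU : IsGraded T U) (d : Fin k → ℤ) :
    IsInvariant T (spectralSum U d) := by
  intro i j
  have hle : spectralSum U d ≤ (spectralSum U d).comap (T i j : H →ₗ[ℂ] H) := by
    refine Submodule.topologicalClosure_minimal _ (iSup_le fun s x hx => ?_)
      ((Submodule.isClosed_topologicalClosure _).preimage (T i j).continuous)
    refine Submodule.le_topologicalClosure _ (Submodule.mem_iSup_of_mem
      ⟨(s : Fin k → ℤ) + Pi.single i 1, s.2.trans (le_add_of_nonneg_right ?_)⟩
      (hU.map_mem i j hx))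
    simp
  exact fun h hh => hle hh

end IsGraded

theorem spectralSubspace_le_spectralSum (U : GaugeGroup k H) {d s : Fin k → ℤ} (h : d ≤ s) :
    spectralSubspace U s ≤ spectralSum U d := fun _ hx =>
  Submodule.le_topologicalClosure _ (Submodule.mem_iSup_of_mem ⟨s, h⟩ hx)

/-- The graded pieces of `spectralSum U d`. -/
noncomputable def gradedPiece (U : GaugeGroup k H) (d : Fin k → ℤ) (q : Fin k → ℕ) :
    Submodule ℂ (spectralSum U d) :=
  (spectralSubspace U (d + fun i => (q i : ℤ))).comap (spectralSum U d).subtype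

theorem le_add_natCast (d : Fin k → ℤ) (q : Fin k → ℕ) : d ≤ d + fun i => (q i : ℤ) :=
  le_add_of_nonneg_right fun i => Int.natCast_nonneg (q i)

theorem add_natCast_single (d : Fin k → ℤ) (q : Fin k → ℕ) (i : Fin k) :
    (d + fun j => ((q + Pi.single i 1 : Fin k → ℕ) j : ℤ)) =
      (d + fun j => (q j : ℤ)) + Pi.single i 1 := by
  ext j
  by_cases hj : j = i
  · subst hj
    simp
    ring
  · simp [hj]

theorem eq_zero_of_forall_gradedPiece (U : GaugeGroup k H) (d : Fin k → ℤ)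
    (y : spectralSum U d) (hy : ∀ q, ∀ x ∈ gradedPiece U d q, ⟪x, y⟫_ℂ = 0) : y = 0 := by
  have h1 : spectralSum U d ≤ (ℂ ∙ (y : H))ᗮ := by
    refine Submodule.topologicalClosure_minimal _ (iSup_le fun s x hx => ?_)
      (Submodule.isClosed_orthogonal _)
    rw [Submodule.mem_orthogonal_singleton_iff_inner_left]
    have hs : (d + fun i => ((((s : Fin k → ℤ) i - d i).toNat : ℕ) : ℤ)) = s := by
      ext i
      have : d i ≤ (s : Fin k → ℤ) i := s.2 i
      simp only [Pi.add_apply]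
      omega
    exact hy (fun i => ((s : Fin k → ℤ) i - d i).toNat)
      ⟨x, spectralSubspace_le_spectralSum U s.2 hx⟩ (by rw [← hs] at hx; exact hx)
  have h2 := h1 y.2
  rw [Submodule.mem_orthogonal_singleton_iff_inner_left, inner_self_eq_zero] at h2
  exact Subtype.ext h2

theorem inner_star_restrict {M : Submodule ℂ H} [CompleteSpace M] (hM : IsInvariant T M) (i : Fin k)
    (j : Fin (n i)) (x y : M) :
    ⟪y, star (restrict T M hM i j) x⟫_ℂ = ⟪(y : H), star (T i j) (x : H)⟫_ℂ := by
  rw [ContinuousLinearMap.star_eq_adjoint, ContinuousLinearMap.adjoint_inner_right,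
    ContinuousLinearMap.star_eq_adjoint, ContinuousLinearMap.adjoint_inner_right]
  rfl

/-- The adjoint of a restriction is the compression of `T_{i,j}^*`, and nothing is lost when the
image already lies in `M`. -/
theorem star_restrict_apply {M : Submodule ℂ H} [CompleteSpace M] (hM : IsInvariant T M) (i : Fin k)
    (j : Fin (n i)) (x : M) (hx : star (T i j) (x : H) ∈ M) :
    (star (restrict T M hM i j) x : H) = star (T i j) (x : H) := by
  have : star (restrict T M hM i j) x = ⟨_, hx⟩ :=
    ext_inner_left ℂ fun y => inner_star_restrict hM i j x y
  rw [this]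

theorem isGradedShift_restrict (hT : MemPolyball T) (hpure : IsPure T) (hrank : HasFiniteRank T)
    (hU : IsGraded T U) {c d : Fin k → ℤ}
    (hcd : ∀ s, ∀ x ∈ spectralSubspace U s, defect T x ≠ 0 → c ≤ s ∧ s ≤ d)
    (hinv : IsInvariant T (spectralSum U d)) :
    IsGradedShift (restrict T (spectralSum U d) hinv) (gradedPiece U d) := by
  have hmap : ∀ (q : Fin k → ℕ) (i j), ∀ x ∈ gradedPiece U d q,
      restrict T (spectralSum U d) hinv i j x ∈ gradedPiece U d (q + Pi.single i 1) := by
    intro q i j x hx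
    have := hU.map_mem i j hx
    rw [← add_natCast_single] at this
    exact this
  have hadj : ∀ (q : Fin k → ℕ) (i j), ∀ x ∈ gradedPiece U d (q + Pi.single i 1),
      star (T i j) (x : H) ∈ spectralSubspace U (d + fun i => (q i : ℤ)) := by
    intro q i j x hx
    have hx' : (x : H) ∈ spectralSubspace U
      (d + fun j => ((q + Pi.single i 1 : Fin k → ℕ) j : ℤ)) := hx
    rw [add_natCast_single] at hx'
    have := hU.adj_mem i j hx'
    rwa [add_sub_cancel_right] at this
  have hstar : ∀ (q : Fin k → ℕ) (i j), ∀ x ∈ gradedPiece U d (q + Pi.single i 1),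
      (star (restrict T (spectralSum U d) hinv i j) x : H) = star (T i j) (x : H) :=
    fun q i j x hx => star_restrict_apply hinv i j x
      (spectralSubspace_le_spectralSum U (le_add_natCast d q) (hadj q i j x hx))
  have hortho : ∀ q r, q ≠ r → ∀ x ∈ gradedPiece U d q, ∀ y ∈ gradedPiece U d r,
      ⟪x, y⟫_ℂ = 0 := by
    intro q r hqr x hx y hy
    refine spectralSubspace_ortho U (fun h => hqr ?_) hx hy
    ext i
    have := congrFun h i
    simp only [Pi.add_apply] at this
    omega
  refine ⟨fun q => ?_, hortho, eq_zero_of_forall_gradedPiece U d, ?_, hmap, ?_, ?_, ?_⟩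
  · have := hU.finiteDimensional_spectralSubspace hT hpure hrank (d + fun i => (q i : ℤ))
    let f : gradedPiece U d q →ₗ[ℂ] spectralSubspace U (d + fun i => (q i : ℤ)) :=
      ((spectralSum U d).subtype.domRestrict _).codRestrict _ fun x => x.2
    exact FiniteDimensional.of_injective f fun x y h =>
      Subtype.ext (Subtype.ext (congrArg (fun v : spectralSubspace U _ => (v : H)) h))
  · intro s t hst i j
    ext x
    exact congrArg (fun A : H →L[ℂ] H => A x) (hT.commute s t hst i j).eq
  · intro q i j x hx
    change (star (restrict T (spectralSum U d) hinv i j) x : H) ∈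
      spectralSubspace U (d + fun i => (q i : ℤ))
    rw [hstar q i j x hx]
    exact hadj q i j x hx
  · intro q i j hq x hx
    -- On the face `q i = 0`, `T_{i,j}^* x` may leave the subspace, but its compression vanishes:
    -- `T_{i,j}` maps each piece to one with positive `i`-th degree, orthogonal to `x`.
    refine eq_zero_of_forall_gradedPiece U d _ fun r y hy => ?_
    rw [ContinuousLinearMap.star_eq_adjoint, ContinuousLinearMap.adjoint_inner_right]
    refine hortho _ _ (fun h => ?_) _ (hmap r i j y hy) _ hx
    have := congrFun h i
    simp [hq] at this
  · intro q i x hx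
    ext
    have hx' : (x : H) ∈ spectralSubspace U
      (d + fun j => ((q + Pi.single i 1 : Fin k → ℕ) j : ℤ)) := hx
    rw [AddSubmonoidClass.coe_finsetSum]
    refine Eq.trans (Finset.sum_congr rfl fun j _ => ?_)
      (hU.sum_apply_star_eq_self hT hpure hcd (i := i) ?_ hx')
    · exact congrArg (T i j) (hstar q i j x hx)
    -- The degree here is `d i + q i + 1`, strictly above `d i`.
    · simp only [Pi.add_apply, Pi.single_eq_same]
      omega

theorem isHilbertSum_spectralSubspace (hT : MemPolyball T) (hpure : IsPure T)
    (hrank : HasFiniteRank T) (hU : IsGraded T U) {c d : Fin k → ℤ}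
    (hcd : ∀ s, ∀ x ∈ spectralSubspace U s, defect T x ≠ 0 → c ≤ s ∧ s ≤ d) :
    IsHilbertSum ℂ (fun s : {s : Fin k → ℤ // c ≤ s} => spectralSubspace U s)
      (fun s => (spectralSubspace U (s : Fin k → ℤ)).subtypeₗᵢ) := by
  have := hU.finiteDimensional_spectralSubspace hT hpure hrank
  refine IsHilbertSum.mkInternal (fun s : {s : Fin k → ℤ // c ≤ s} => spectralSubspace U s)
    ((orthogonalFamily_spectralSubspace U).comp Subtype.val_injective) ?_
  rw [top_le_iff, Submodule.topologicalClosure_eq_top_iff, Submodule.eq_bot_iff]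
  intro y hy
  refine eq_zero_of_forall_spectralSubspace U fun s x hx => ?_
  by_cases hx0 : x = 0
  · rw [hx0, inner_zero_right]
  · have hs := hU.le_of_mem_spectralSubspace hT hpure hcd hx hx0
    exact (Submodule.mem_orthogonal' _ _).1 hy x (Submodule.mem_iSup_of_mem ⟨s, hs⟩ hx)

end Restriction

end Polyball

theorem theorem3p4 {H : Type*} [NormedAddCommGroup H] [InnerProductSpace ℂ H] [CompleteSpace H]
    {k : ℕ} (n : Fin k → ℕ) (hn : ∀ i, 2 ≤ n i) (T : Polyball.OpTuple n H)
    (hT : Polyball.MemPolyball T) (hpure : Polyball.IsPure T) (hrank : Polyball.HasFiniteRank T)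
    (U : Polyball.GaugeGroup k H) (hU : Polyball.IsGraded T U) :
    (∀ s : Fin k → ℤ, FiniteDimensional ℂ (Polyball.spectralSubspace U s)) ∧
    ∃ c d : Fin k → ℤ, c ≤ d ∧
      IsHilbertSum ℂ (fun s : {s : Fin k → ℤ // c ≤ s} => Polyball.spectralSubspace U s)
        (fun s => (Polyball.spectralSubspace U (s : Fin k → ℤ)).subtypeₗᵢ) ∧
      ∃ hinv : Polyball.IsInvariant T (Polyball.spectralSum U d),
        Polyball.MemPolyball (Polyball.restrict T (Polyball.spectralSum U d) hinv) ∧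
        Polyball.HasFiniteRank (Polyball.restrict T (Polyball.spectralSum U d) hinv) ∧
        ∃ x : ℝ,
          Polyball.HasCurvature (Polyball.restrict T (Polyball.spectralSum U d) hinv) x ∧
          Polyball.HasEulerChar (Polyball.restrict T (Polyball.spectralSum U d) hinv) x := by
  refine ⟨hU.finiteDimensional_spectralSubspace hT hpure hrank, ?_⟩
  obtain ⟨c, d, hle, hcd⟩ := hU.exists_bounds hrank
  have hinv := hU.isInvariant_spectralSum d
  have hR := Polyball.isGradedShift_restrict hT hpure hrank hU hcd hinv
  have hn1 : ∀ i, 1 ≤ n i := fun i => one_le_two.trans (hn i)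
  obtain ⟨x, C, hx, hC⟩ := hR.exists_tendsto_dimRatio hn1
  exact ⟨c, d, hle, Polyball.isHilbertSum_spectralSubspace hT hpure hrank hU hcd, hinv,
    hR.memPolyball, hR.hasFiniteRank, x, hR.hasCurvature hx hC, hR.hasEulerChar hn1 hx hC⟩
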